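/- Let $d\ge 2$ and let $\Omega\subset\mathbb R^d$ be a bounded domain with Lipschitz boundary $\Gamma=\Gamma_0\cup\Gamma_1$, where $\Gamma_0,\Gamma_1$ are relatively open subsets of $\Gamma$ with $\overline{\Gamma_0}\cap\overline{\Gamma_1}=\emptyset$ and $\Gamma_1\neq\emptyset$. Let $a>0$, $b\in\mathbb R\setminus\{0\}$, $\gamma>0$, $\alpha\in(0,1)$, $\eta\ge 0$, and put $$\mu(\xi)=|\xi|^{\frac{2\alpha-d}{2}},\qquad \kappa=\kappa(\alpha,d)=\frac{2\sin(\alpha\pi)\,\Gamma(\frac d2+1)}{d\,\pi^{\frac d2+1}} .$$ Let $H^1_{\Gamma_0}(\Omega)=\{u\in H^1(\Omega): u=0 \text{ on }\Gamma_0\}$ (all spaces are complex) and $$\mathcal H=H^1_{\Gamma_0}(\Omega)\times L^2(\Omega)\times H^1_0(\Omega)\times L^2(\Omega)\times L^2(\Gamma_1\times\mathbb R^d),$$ $$\|(u,v,y,z,\omega)\|_{\mathcal H}^2=\int_\Omega\left(|v|^2+|\nabla u|^2+|z|^2+a|\nabla y|^2\right)dx+\gamma\kappa\int_{\Gamma_1}\int_{\mathbb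 R^d}|\omega(x,\xi)|^2\,d\xi\,d\Gamma .$$ Let $\mathcal A$ be the unbounded operator in $\mathcal H$ whose domain $D(\mathcal A)$ consists of all $U=(u,v,y,z,\omega)\in\mathcal H$ such that $\Delta u\in L^2(\Omega)$, $y\in H^2(\Omega)\cap H^1_0(\Omega)$, $v\in H^1_{\Gamma_0}(\Omega)$, $z\in H^1_0(\Omega)$, $-(|\xi|^2+\eta)\omega+v|_{\Gamma_1}\mu(\xi)\in L^2(\Gamma_1\times\mathbb R^d)$, $|\xi|\omega\in L^2(\Gamma_1\times\mathbb R^d)$ and $\frac{\partial u}{\partial\nu}+\gamma\kappa\int_{\mathbb R^d}\mu(\xi)\omega(\cdot,\xi)\,d\xi=0$ on $\Gamma_1$ (in the weak sense given by Green's formula), with $$\mathcal A(u,v,y,z,\omega)=\left(v,\ \Delta u-bz,\ z,\ a\Delta y+bv,\ -(|\xi|^2+\eta)\omega+v|_{\Gamma_1}\mu(\xi)\right).$$ Assume that $\eta=0$. Then $-\mathcal A$ is not invertible (it is not a bijection of $D(\mathcal A)$ onto $\mathcal H$ with bounded inverse), and consequently $0\in\sigma(\mathcal A)$. Moreover, there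 exist $\varphi\in H^1_{\Gamma_0}(\Omega)$ whose trace $\varphi|_{\Gamma_1}$ does not vanish almost everywhere on $\Gamma_1$, and for every such $\varphi$ the function $(x,\xi)\mapsto|\xi|^{\frac{2\alpha-d-4}{2}}\varphi|_{\Gamma_1}(x)$ is not in $L^2(\Gamma_1\times\mathbb R^d)$ and there is no $U\in D(\mathcal A)$ with $-\mathcal A U=(\varphi,0,0,0,0)$. -/

import Mathlib

open MeasureTheory Filter Topology
open scoped ContDiff ENNReal

noncomputable section

namespace CoupledWave

/-! ## Domains with Lipschitz boundary -/

/-- The Euclidean space `ℝ^d`. -/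
abbrev E (d : ℕ) : Type := EuclideanSpace ℝ (Fin d)

variable {d : ℕ}

/-- `Ω` has a Lipschitz boundary: near each boundary point there is a unit direction `e` and a
Lipschitz function `h` of the component of `y` orthogonal to `e`, such that `Ω` is locally the set
of points lying strictly above the graph of `h` in direction `e`. -/
def HasLipschitzBoundary (Ω : Set (E d)) : Prop :=
  ∀ x ∈ frontier Ω, ∃ (e : E d) (h : E d → ℝ) (K : NNReal) (r : ℝ),
    ‖e‖ = 1 ∧ LipschitzWith K h ∧ 0 < r ∧
      ∀ y ∈ Metric.ball x r, (y ∈ Ω ↔ h (y - inner ℝ e y • e) < inner ℝ e y)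

/-- The geometric setting: `Ω` is a bounded domain with Lipschitz boundary
`Γ = Γ₀ ∪ Γ₁`, where `Γ₀`, `Γ₁` are relatively open in `Γ`, have disjoint closures, and `Γ₁` is
non-empty. -/
structure IsAdmissible (Ω Γ₀ Γ₁ : Set (E d)) : Prop where
  isOpen : IsOpen Ω
  isConnected : IsConnected Ω
  isBounded : Bornology.IsBounded Ω
  lipschitz : HasLipschitzBoundary Ω
  union : Γ₀ ∪ Γ₁ = frontier Ω
  relOpen₀ : ∃ O : Set (E d), IsOpen O ∧ Γ₀ = O ∩ frontier Ω
  relOpen₁ : ∃ O : Set (E d), IsOpen O ∧ Γ₁ = O ∩ frontier Ω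
  disjoint : Disjoint (closure Γ₀) (closure Γ₁)
  nonempty₁ : Γ₁.Nonempty

/-- Surface measure on `Γ = ∂Ω`: the `(d-1)`-dimensional Hausdorff measure (normalised as in
Euclidean geometry) restricted to `∂Ω`. -/
def surf (Ω : Set (E d)) : Measure (E d) :=
  (Measure.euclideanHausdorffMeasure (d - 1) : Measure (E d)).restrict (frontier Ω)

/-- The measure `dΓ dξ` on `Γ₁ × ℝ^d`. -/
def surfProd (Ω Γ₁ : Set (E d)) : Measure (E d × E d) :=
  ((surf Ω).restrict Γ₁).prod volume

/-- `L²(Ω)`, complex valued. -/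
abbrev L2 (Ω : Set (E d)) : Type := Lp ℂ 2 ((volume : Measure (E d)).restrict Ω)

/-- `L²(Γ)`. -/
abbrev L2bd (Ω : Set (E d)) : Type := Lp ℂ 2 (surf Ω)

/-- `L²(Γ₁)`. -/
abbrev L2bd₁ (Ω Γ₁ : Set (E d)) : Type := Lp ℂ 2 ((surf Ω).restrict Γ₁)

/-- `L²(Γ₁ × ℝ^d)`. -/
abbrev L2aux (Ω Γ₁ : Set (E d)) : Type := Lp ℂ 2 (surfProd Ω Γ₁)

/-! ## Sobolev spaces -/

/-- The `i`-th classical partial derivative. -/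
def pd {F : Type*} [NormedAddCommGroup F] [NormedSpace ℝ F] (i : Fin d) (φ : E d → F) (x : E d) :
    F :=
  fderiv ℝ φ x (EuclideanSpace.single i 1)

/-- Real test functions on `Ω`. -/
structure IsTest (Ω : Set (E d)) (φ : E d → ℝ) : Prop where
  smooth : ContDiff ℝ ∞ φ
  compact : HasCompactSupport φ
  subset : tsupport φ ⊆ Ω

lemma contDiff_pd {F : Type*} [NormedAddCommGroup F] [NormedSpace ℝ F] (i : Fin d) {φ : E d → F}
    (h : ContDiff ℝ ∞ φ) : ContDiff ℝ ∞ (pd i φ) :=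
  (h.fderiv_right (m := ∞) (by simp)).clm_apply contDiff_const

lemma IsTest.pd {Ω : Set (E d)} {φ : E d → ℝ} (h : IsTest Ω φ) (i : Fin d) :
    IsTest Ω (CoupledWave.pd i φ) where
  smooth := contDiff_pd i h.smooth
  compact := h.compact.fderiv_apply (𝕜 := ℝ) _
  subset := (tsupport_fderiv_apply_subset ℝ _).trans h.subset

/-- A continuous compactly supported weight times an `L²(Ω)` function is integrable. -/
lemma IsTest.integrable_smul {Ω : Set (E d)} {φ : E d → ℝ} (h : IsTest Ω φ) (u : L2 Ω) :
    Integrable (fun x => φ x • u x) (volume.restrict Ω) := by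
  have h1 : MemLp φ 2 ((volume : Measure (E d)).restrict Ω) :=
    (h.smooth.continuous.memLp_of_hasCompactSupport h.compact).restrict Ω
  exact MemLp.integrable_mul (Lp.memLp u) h1.ofReal |>.congr (by
    filter_upwards with x
    simp [mul_comm])

lemma integral_smul_zero {Ω : Set (E d)} (ψ : E d → ℝ) :
    ∫ x in Ω, ψ x • (0 : L2 Ω) x = 0 := by
  apply integral_eq_zero_of_ae
  filter_upwards [Lp.coeFn_zero ℂ 2 ((volume : Measure (E d)).restrict Ω)] with x hx
  rw [hx]
  simp only [Pi.zero_apply, smul_zero]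

lemma integral_smul_add {Ω : Set (E d)} {ψ : E d → ℝ} (hψ : IsTest Ω ψ) (f g : L2 Ω) :
    ∫ x in Ω, ψ x • (f + g) x = (∫ x in Ω, ψ x • f x) + ∫ x in Ω, ψ x • g x := by
  rw [← integral_add (hψ.integrable_smul f) (hψ.integrable_smul g)]
  apply integral_congr_ae
  filter_upwards [Lp.coeFn_add f g] with x hx
  rw [hx, Pi.add_apply, smul_add]

lemma integral_smul_smul {Ω : Set (E d)} (ψ : E d → ℝ) (c : ℂ) (f : L2 Ω) :
    ∫ x in Ω, ψ x • (c • f) x = c * ∫ x in Ω, ψ x • f x := by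
  rw [← integral_const_mul]
  apply integral_congr_ae
  filter_upwards [Lp.coeFn_smul c f] with x hx
  rw [hx, Pi.smul_apply, smul_eq_mul, Complex.real_smul, Complex.real_smul]
  ring

/-- The graph of the weak derivative `∂_i` in `L²(Ω)`. -/
def weakPartialGraph (Ω : Set (E d)) (i : Fin d) : Submodule ℂ (L2 Ω × L2 Ω) where
  carrier := {p | ∀ φ : E d → ℝ, IsTest Ω φ →
    ∫ x in Ω, pd i φ x • p.1 x = - ∫ x in Ω, φ x • p.2 x}
  zero_mem' := by
    intro φ hφ
    simp only [Prod.fst_zero, Prod.snd_zero, integral_smul_zero, neg_zero]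
  add_mem' := by
    intro p q hp hq φ hφ
    have h1 := hp φ hφ
    have h2 := hq φ hφ
    simp only [Prod.fst_add, Prod.snd_add]
    rw [integral_smul_add (hφ.pd i), integral_smul_add hφ, h1, h2]
    ring
  smul_mem' := by
    intro c p hp φ hφ
    have h1 := hp φ hφ
    simp only [Prod.smul_fst, Prod.smul_snd]
    rw [integral_smul_smul, integral_smul_smul, h1]
    ring

/-- An `L²(Ω)` function that integrates to zero against every test function vanishes. -/
lemma eq_zero_of_test {Ω : Set (E d)} (hΩ : IsOpen Ω) (f : L2 Ω)
    (h : ∀ φ : E d → ℝ, IsTest Ω φ → ∫ x in Ω, φ x • f x = 0) : f = 0 := by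
  have hloc : LocallyIntegrable f ((volume : Measure (E d)).restrict Ω) :=
    (Lp.memLp f).locallyIntegrable (by norm_num)
  have h1 := IsOpen.ae_eq_zero_of_integral_contDiff_smul_eq_zero
    (μ := (volume : Measure (E d)).restrict Ω) hΩ (hloc.locallyIntegrableOn Ω)
    (fun g g1 g2 g3 => h g ⟨g1, g2, g3⟩)
  rw [Lp.eq_zero_iff_ae_eq_zero]
  filter_upwards [h1, ae_restrict_mem hΩ.measurableSet] with x hx hxΩ
  simpa using hx hxΩ

/-- Weak derivatives are unique. -/
lemma weakPartialGraph_unique {Ω : Set (E d)} (hΩ : IsOpen Ω) (i : Fin d) (p : L2 Ω × L2 Ω)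
    (hp : p ∈ weakPartialGraph Ω i) (h0 : p.1 = 0) : p.2 = 0 := by
  refine eq_zero_of_test hΩ _ fun φ hφ => ?_
  have h1 := hp φ hφ
  rw [h0, integral_smul_zero] at h1
  exact neg_eq_zero.mp h1.symm

/-- The weak derivative `∂_i` as a partially defined operator in `L²(Ω)`. -/
def weakPartial (Ω : Set (E d)) (i : Fin d) : L2 Ω →ₗ.[ℂ] L2 Ω :=
  (weakPartialGraph Ω i).toLinearPMap

/-- `H¹(Ω)`, as a subspace of `L²(Ω)`. -/
def H1 (Ω : Set (E d)) : Submodule ℂ (L2 Ω) := ⨅ i, (weakPartial Ω i).domain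

/-- The weak derivative `∂_i : H¹(Ω) → L²(Ω)`. -/
def D (Ω : Set (E d)) (i : Fin d) : H1 Ω →ₗ[ℂ] L2 Ω :=
  (weakPartial Ω i).toFun ∘ₗ Submodule.inclusion (iInf_le _ i)

lemma D_spec {Ω : Set (E d)} (hΩ : IsOpen Ω) (i : Fin d) (u : H1 Ω) (φ : E d → ℝ)
    (hφ : IsTest Ω φ) :
    ∫ x in Ω, pd i φ x • (u : L2 Ω) x = - ∫ x in Ω, φ x • D Ω i u x :=
  Submodule.mem_graph_toLinearPMap (fun p hp h0 => weakPartialGraph_unique hΩ i p hp h0)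
    (Submodule.inclusion (iInf_le _ i) u) φ hφ

/-- `H²(Ω)`: functions of `H¹(Ω)` with first order derivatives in `H¹(Ω)`. -/
def H2 (Ω : Set (E d)) : Submodule ℂ (L2 Ω) where
  carrier := {u | ∃ hu : u ∈ H1 Ω, ∀ i, D Ω i ⟨u, hu⟩ ∈ H1 Ω}
  zero_mem' := ⟨zero_mem _, fun i => by
    have : D Ω i ⟨0, zero_mem _⟩ = 0 := map_zero (D Ω i)
    rw [this]; exact zero_mem _⟩
  add_mem' := by
    rintro u v ⟨hu, hu'⟩ ⟨hv, hv'⟩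
    refine ⟨add_mem hu hv, fun i => ?_⟩
    have : D Ω i ⟨u + v, add_mem hu hv⟩ = D Ω i ⟨u, hu⟩ + D Ω i ⟨v, hv⟩ :=
      map_add (D Ω i) ⟨u, hu⟩ ⟨v, hv⟩
    rw [this]; exact add_mem (hu' i) (hv' i)
  smul_mem' := by
    rintro c u ⟨hu, hu'⟩
    refine ⟨Submodule.smul_mem _ c hu, fun i => ?_⟩
    have : D Ω i ⟨c • u, Submodule.smul_mem _ c hu⟩ = c • D Ω i ⟨u, hu⟩ :=
      map_smul (D Ω i) c ⟨u, hu⟩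
    rw [this]; exact Submodule.smul_mem _ c (hu' i)

/-- The sequence of (smooth) functions `φ n` converges to `u` in the norm of `H¹(Ω)`. -/
def TendstoH1 (Ω : Set (E d)) (φ : ℕ → E d → ℂ) (u : H1 Ω) : Prop :=
  Tendsto (fun n => eLpNorm (φ n - ⇑(u : L2 Ω)) 2 (volume.restrict Ω)) atTop (𝓝 0) ∧
  ∀ i, Tendsto (fun n => eLpNorm (pd i (φ n) - ⇑(D Ω i u)) 2 (volume.restrict Ω)) atTop (𝓝 0)

/-- Auxiliary: `L²`-convergence (towards an `L²` class) is additive. -/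
lemma tendsto_eLpNorm_add {μ : Measure (E d)} {φ ψ : ℕ → E d → ℂ} {u v : Lp ℂ 2 μ}
    (hφ : ∀ n, Continuous (φ n)) (hψ : ∀ n, Continuous (ψ n))
    (h1 : Tendsto (fun n => eLpNorm (φ n - ⇑u) 2 μ) atTop (𝓝 0))
    (h2 : Tendsto (fun n => eLpNorm (ψ n - ⇑v) 2 μ) atTop (𝓝 0)) :
    Tendsto (fun n => eLpNorm (φ n + ψ n - ⇑(u + v)) 2 μ) atTop (𝓝 0) := by
  have h3 := h1.add h2
  rw [add_zero] at h3
  refine tendsto_of_tendsto_of_tendsto_of_le_of_le tendsto_const_nhds h3 (fun _ => zero_le) ?_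
  intro n
  have : φ n + ψ n - ⇑(u + v) =ᵐ[μ] (φ n - ⇑u) + (ψ n - ⇑v) := by
    filter_upwards [Lp.coeFn_add u v] with x hx
    simp only [Pi.sub_apply, Pi.add_apply, hx]
    ring
  calc eLpNorm (φ n + ψ n - ⇑(u + v)) 2 μ = eLpNorm ((φ n - ⇑u) + (ψ n - ⇑v)) 2 μ :=
        eLpNorm_congr_ae this
    _ ≤ _ := eLpNorm_add_le ((hφ n).aestronglyMeasurable.sub (Lp.aestronglyMeasurable u))
        ((hψ n).aestronglyMeasurable.sub (Lp.aestronglyMeasurable v)) (by norm_num)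

/-- Auxiliary: `L²`-convergence is homogeneous. -/
lemma tendsto_eLpNorm_smul {μ : Measure (E d)} {φ : ℕ → E d → ℂ} {u : Lp ℂ 2 μ} (c : ℂ)
    (h1 : Tendsto (fun n => eLpNorm (φ n - ⇑u) 2 μ) atTop (𝓝 0)) :
    Tendsto (fun n => eLpNorm (c • φ n - ⇑(c • u)) 2 μ) atTop (𝓝 0) := by
  have h3 : Tendsto (fun n => ‖c‖ₑ * eLpNorm (φ n - ⇑u) 2 μ) atTop (𝓝 0) := by
    simpa using ENNReal.Tendsto.const_mul h1 (Or.inr (by simp))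
  refine h3.congr fun n => ?_
  rw [← eLpNorm_const_smul]
  apply eLpNorm_congr_ae
  filter_upwards [Lp.coeFn_smul c u] with x hx
  simp only [Pi.sub_apply, Pi.smul_apply, hx, smul_sub]

/-- Auxiliary: the constant sequence `0` converges to the class `0`. -/
lemma tendsto_eLpNorm_zero {μ : Measure (E d)} :
    Tendsto (fun _ : ℕ => eLpNorm ((0 : E d → ℂ) - ⇑(0 : Lp ℂ 2 μ)) 2 μ) atTop (𝓝 0) := by
  have : eLpNorm ((0 : E d → ℂ) - ⇑(0 : Lp ℂ 2 μ)) 2 μ = 0 := by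
    rw [← eLpNorm_zero (ε := ℂ) (μ := μ) (p := 2)]
    apply eLpNorm_congr_ae
    filter_upwards [Lp.coeFn_zero ℂ 2 μ] with x hx
    rw [Pi.sub_apply, hx]
    simp
  rw [this]
  exact tendsto_const_nhds

lemma pd_add {i : Fin d} {φ ψ : E d → ℂ} (hφ : ContDiff ℝ ∞ φ) (hψ : ContDiff ℝ ∞ ψ) :
    pd i (φ + ψ) = pd i φ + pd i ψ := by
  ext x
  simp only [pd, Pi.add_apply]
  rw [fderiv_add (hφ.differentiable (by simp) x) (hψ.differentiable (by simp) x)]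
  rfl

lemma pd_smul {i : Fin d} {φ : E d → ℂ} (hφ : ContDiff ℝ ∞ φ) (c : ℂ) :
    pd i (c • φ) = c • pd i φ := by
  ext x
  simp only [pd, Pi.smul_apply]
  rw [fderiv_const_smul (hφ.differentiable (by simp) x)]
  rfl

lemma pd_zero {i : Fin d} : pd i (0 : E d → ℂ) = 0 := by
  ext x
  simp [pd]

lemma TendstoH1.add {Ω : Set (E d)} {φ ψ : ℕ → E d → ℂ} {u v : H1 Ω}
    (hφ : ∀ n, ContDiff ℝ ∞ (φ n)) (hψ : ∀ n, ContDiff ℝ ∞ (ψ n))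
    (h1 : TendstoH1 Ω φ u) (h2 : TendstoH1 Ω ψ v) :
    TendstoH1 Ω (fun n => φ n + ψ n) (u + v) := by
  refine ⟨tendsto_eLpNorm_add (fun n => (hφ n).continuous) (fun n => (hψ n).continuous) h1.1 h2.1,
    fun i => ?_⟩
  have := tendsto_eLpNorm_add (fun n => (contDiff_pd i (hφ n)).continuous)
    (fun n => (contDiff_pd i (hψ n)).continuous) (h1.2 i) (h2.2 i)
  simpa only [pd_add (hφ _) (hψ _), map_add] using this

lemma TendstoH1.smul {Ω : Set (E d)} {φ : ℕ → E d → ℂ} {u : H1 Ω} (c : ℂ)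
    (hφ : ∀ n, ContDiff ℝ ∞ (φ n)) (h1 : TendstoH1 Ω φ u) :
    TendstoH1 Ω (fun n => c • φ n) (c • u) := by
  refine ⟨tendsto_eLpNorm_smul c h1.1, fun i => ?_⟩
  have := tendsto_eLpNorm_smul c (h1.2 i)
  simpa only [pd_smul (hφ _), map_smul] using this

lemma TendstoH1.zero {Ω : Set (E d)} : TendstoH1 Ω (fun _ => 0) (0 : H1 Ω) := by
  refine ⟨tendsto_eLpNorm_zero, fun i => ?_⟩
  simp only [pd_zero, map_zero]
  exact tendsto_eLpNorm_zero

/-- The graph of the trace operator: the closure in `H¹(Ω) × L²(Γ)` of the set of pairs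
`(φ|_Ω, φ|_Γ)` with `φ` smooth on `ℝ^d`. -/
def traceGraph (Ω : Set (E d)) : Submodule ℂ (L2 Ω × L2bd Ω) where
  carrier := {p | ∃ hu : p.1 ∈ H1 Ω, ∃ φ : ℕ → E d → ℂ, (∀ n, ContDiff ℝ ∞ (φ n)) ∧
    TendstoH1 Ω φ ⟨p.1, hu⟩ ∧
    Tendsto (fun n => eLpNorm (φ n - ⇑p.2) 2 (surf Ω)) atTop (𝓝 0)}
  zero_mem' := by
    refine ⟨zero_mem _, fun _ => 0, fun _ => contDiff_const, ?_, ?_⟩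
    · exact TendstoH1.zero
    · exact tendsto_eLpNorm_zero
  add_mem' := by
    rintro p q ⟨hp, φ, h1, h2, h3⟩ ⟨hq, ψ, k1, k2, k3⟩
    refine ⟨add_mem hp hq, fun n => φ n + ψ n, fun n => (h1 n).add (k1 n), ?_, ?_⟩
    · have h := TendstoH1.add h1 k1 h2 k2
      exact h
    · have h := tendsto_eLpNorm_add (fun n => (h1 n).continuous) (fun n => (k1 n).continuous) h3 k3
      exact h
  smul_mem' := by
    rintro c p ⟨hp, φ, h1, h2, h3⟩
    refine ⟨Submodule.smul_mem _ c hp, fun n => c • φ n, fun n => (h1 n).const_smul c, ?_, ?_⟩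
    · have h := TendstoH1.smul c h1 h2
      exact h
    · exact tendsto_eLpNorm_smul c h3

/-- The trace operator `u ↦ u|_Γ`, the continuous extension to `H¹(Ω)` of the restriction
to `Γ` of smooth functions (an everywhere defined bounded operator `H¹(Ω) → L²(Γ)` when the
boundary is Lipschitz). -/
def trace (Ω : Set (E d)) : L2 Ω →ₗ.[ℂ] L2bd Ω := (traceGraph Ω).toLinearPMap

/-- `H¹_{Γ₀}(Ω)`: functions of `H¹(Ω)` whose trace vanishes on `Γ₀`. -/
def H1Γ₀ (Ω Γ₀ : Set (E d)) : Submodule ℂ (L2 Ω) where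
  carrier := {u | u ∈ H1 Ω ∧ ∃ hu : u ∈ (trace Ω).domain,
    trace Ω ⟨u, hu⟩ =ᵐ[(surf Ω).restrict Γ₀] 0}
  zero_mem' := by
    refine ⟨zero_mem _, zero_mem _, ?_⟩
    have : trace Ω ⟨0, zero_mem _⟩ = 0 := LinearPMap.map_zero _
    rw [this]
    exact ae_restrict_of_ae (Lp.coeFn_zero ℂ 2 (surf Ω))
  add_mem' := by
    rintro u v ⟨hu1, hu, hu'⟩ ⟨hv1, hv, hv'⟩
    refine ⟨add_mem hu1 hv1, add_mem hu hv, ?_⟩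
    have : trace Ω ⟨u + v, add_mem hu hv⟩ = trace Ω ⟨u, hu⟩ + trace Ω ⟨v, hv⟩ :=
      LinearPMap.map_add _ ⟨u, hu⟩ ⟨v, hv⟩
    rw [this]
    filter_upwards [ae_restrict_of_ae (Lp.coeFn_add (trace Ω ⟨u, hu⟩) (trace Ω ⟨v, hv⟩)), hu', hv']
      with x h1 h2 h3
    rw [h1, Pi.add_apply, h2, h3]
    simp
  smul_mem' := by
    rintro c u ⟨hu1, hu, hu'⟩
    refine ⟨Submodule.smul_mem _ c hu1, Submodule.smul_mem _ c hu, ?_⟩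
    have : trace Ω ⟨c • u, Submodule.smul_mem _ c hu⟩ = c • trace Ω ⟨u, hu⟩ :=
      LinearPMap.map_smul _ c ⟨u, hu⟩
    rw [this]
    filter_upwards [ae_restrict_of_ae (Lp.coeFn_smul c (trace Ω ⟨u, hu⟩)), hu'] with x h1 h2
    rw [h1, Pi.smul_apply, h2]
    simp

/-- `H¹_0(Ω)`: the closure of the smooth functions with compact support in `Ω`, in `H¹(Ω)`. -/
def H10 (Ω : Set (E d)) : Submodule ℂ (L2 Ω) where
  carrier := {u | ∃ hu : u ∈ H1 Ω, ∃ φ : ℕ → E d → ℂ, (∀ n, ContDiff ℝ ∞ (φ n)) ∧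
    (∀ n, HasCompactSupport (φ n) ∧ tsupport (φ n) ⊆ Ω) ∧ TendstoH1 Ω φ ⟨u, hu⟩}
  zero_mem' := by
    refine ⟨zero_mem _, fun _ => 0, fun _ => contDiff_const, fun _ => ⟨?_, ?_⟩, ?_⟩
    · exact HasCompactSupport.zero
    · simp [tsupport]
    · exact TendstoH1.zero
  add_mem' := by
    rintro u v ⟨hu, φ, h1, h2, h3⟩ ⟨hv, ψ, k1, k2, k3⟩
    refine ⟨add_mem hu hv, fun n => φ n + ψ n, fun n => (h1 n).add (k1 n), fun n => ⟨?_, ?_⟩, ?_⟩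
    · have h := HasCompactSupport.add (h2 n).1 (k2 n).1
      exact h
    · exact (tsupport_add _ _).trans (Set.union_subset (h2 n).2 (k2 n).2)
    · have h := TendstoH1.add h1 k1 h3 k3
      exact h
  smul_mem' := by
    rintro c u ⟨hu, φ, h1, h2, h3⟩
    have hs : ∀ n, tsupport (c • φ n) ⊆ tsupport (φ n) := fun n =>
      closure_mono (Function.support_const_smul_subset c (φ n))
    refine ⟨Submodule.smul_mem _ c hu, fun n => c • φ n, fun n => (h1 n).const_smul c,
      fun n => ⟨?_, (hs n).trans (h2 n).2⟩, ?_⟩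
    · exact (h2 n).1.of_isClosed_subset (isClosed_tsupport _) (hs n)
    · have h := TendstoH1.smul c h1 h3
      exact h

lemma H1Γ₀_le_H1 (Ω Γ₀ : Set (E d)) : H1Γ₀ Ω Γ₀ ≤ H1 Ω := fun _ h => h.1

lemma H1Γ₀_le_trace (Ω Γ₀ : Set (E d)) : H1Γ₀ Ω Γ₀ ≤ (trace Ω).domain := fun _ h => h.2.choose

lemma H10_le_H1 (Ω : Set (E d)) : H10 Ω ≤ H1 Ω := fun _ h => h.choose

/-- The trace `H¹_{Γ₀}(Ω) → L²(Γ)`. -/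
def traceΓ₀ (Ω Γ₀ : Set (E d)) : H1Γ₀ Ω Γ₀ →ₗ[ℂ] L2bd Ω :=
  (trace Ω).toFun ∘ₗ Submodule.inclusion (H1Γ₀_le_trace Ω Γ₀)

/-- The weak derivative `∂_i` on `H¹_{Γ₀}(Ω)`. -/
def DΓ₀ (Ω Γ₀ : Set (E d)) (i : Fin d) : H1Γ₀ Ω Γ₀ →ₗ[ℂ] L2 Ω :=
  D Ω i ∘ₗ Submodule.inclusion (H1Γ₀_le_H1 Ω Γ₀)

/-- The weak derivative `∂_i` on `H¹_0(Ω)`. -/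
def D0 (Ω : Set (E d)) (i : Fin d) : H10 Ω →ₗ[ℂ] L2 Ω :=
  D Ω i ∘ₗ Submodule.inclusion (H10_le_H1 Ω)

/-! ## Laplacian and normal derivative -/

/-- The graph of the weak Laplacian: `u ∈ H¹(Ω)`, `f ∈ L²(Ω)` and
`∫_Ω ∇u · ∇φ = - ∫_Ω f φ` for all test functions `φ`. -/
def laplacianGraph (Ω : Set (E d)) : Submodule ℂ (L2 Ω × L2 Ω) where
  carrier := {p | ∃ hu : p.1 ∈ H1 Ω, ∀ φ : E d → ℝ, IsTest Ω φ →
    ∑ i, ∫ x in Ω, pd i φ x • D Ω i ⟨p.1, hu⟩ x = - ∫ x in Ω, φ x • p.2 x}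
  zero_mem' := by
    refine ⟨zero_mem _, fun φ hφ => ?_⟩
    have h1 : ∀ i, D Ω i ⟨(0 : L2 Ω × L2 Ω).1, zero_mem _⟩ = 0 := fun i => map_zero (D Ω i)
    simp only [h1, integral_smul_zero, Prod.snd_zero, Finset.sum_const_zero, neg_zero]
  add_mem' := by
    rintro p q ⟨hp, hp'⟩ ⟨hq, hq'⟩
    refine ⟨add_mem hp hq, fun φ hφ => ?_⟩
    have h1 : ∀ i, D Ω i ⟨(p + q).1, add_mem hp hq⟩ = D Ω i ⟨p.1, hp⟩ + D Ω i ⟨q.1, hq⟩ :=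
      fun i => map_add (D Ω i) ⟨p.1, hp⟩ ⟨q.1, hq⟩
    have h2 := hp' φ hφ
    have h3 := hq' φ hφ
    simp only [h1, Prod.snd_add, integral_smul_add (hφ.pd _), integral_smul_add hφ, Finset.sum_add_distrib, h2, h3]
    ring
  smul_mem' := by
    rintro c p ⟨hp, hp'⟩
    refine ⟨Submodule.smul_mem _ c hp, fun φ hφ => ?_⟩
    have h1 : ∀ i, D Ω i ⟨(c • p).1, Submodule.smul_mem _ c hp⟩ = c • D Ω i ⟨p.1, hp⟩ :=
      fun i => map_smul (D Ω i) c ⟨p.1, hp⟩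
    have h2 := hp' φ hφ
    simp only [h1, Prod.smul_snd, integral_smul_smul, ← Finset.mul_sum, h2]
    ring

/-- The weak Laplacian is unique. -/
lemma laplacianGraph_unique {Ω : Set (E d)} (hΩ : IsOpen Ω) (p : L2 Ω × L2 Ω)
    (hp : p ∈ laplacianGraph Ω) (h0 : p.1 = 0) : p.2 = 0 := by
  obtain ⟨u, f⟩ := p
  obtain rfl : u = 0 := h0
  obtain ⟨hu, h⟩ := hp
  refine eq_zero_of_test hΩ _ fun φ hφ => ?_
  have h1 := h φ hφ
  have h2 : ∀ i, D Ω i ⟨((0, f) : L2 Ω × L2 Ω).1, hu⟩ = 0 := fun i => map_zero (D Ω i)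
  simp only [h2, integral_smul_zero, Finset.sum_const_zero] at h1
  exact neg_eq_zero.mp h1.symm

/-- The weak Laplacian, with domain `{u ∈ H¹(Ω) : Δu ∈ L²(Ω)}`. -/
def lap (Ω : Set (E d)) : L2 Ω →ₗ.[ℂ] L2 Ω := (laplacianGraph Ω).toLinearPMap

/-- For `u ∈ H¹(Ω)` with `Δu ∈ L²(Ω)` and `g ∈ L²(Γ₁)`: `∂u/∂ν = g` on `Γ₁` in the weak sense,
i.e. `∫_Ω Δu ψ̄ + ∫_Ω ∇u · ∇ψ̄ = ∫_{Γ₁} g ψ̄ dΓ` for all `ψ ∈ H¹_{Γ₀}(Ω)`. -/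
def HasNormalDeriv (Ω Γ₀ Γ₁ : Set (E d)) (u : H1 Ω) (Δu : L2 Ω) (g : L2bd₁ Ω Γ₁) : Prop :=
  ∀ ψ : H1Γ₀ Ω Γ₀,
    inner ℂ (ψ : L2 Ω) Δu + ∑ i, inner ℂ (DΓ₀ Ω Γ₀ i ψ) (D Ω i u)
      = ∫ x in Γ₁, g x * star (traceΓ₀ Ω Γ₀ ψ x) ∂(surf Ω)

/-- Functions in `H²(Ω)` have their Laplacian in `L²(Ω)`. -/
lemma H2_le_lap {Ω : Set (E d)} (hΩ : IsOpen Ω) : H2 Ω ≤ (lap Ω).domain := by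
  rintro u ⟨hu, hu'⟩
  refine Submodule.mem_map.2 ⟨(u, ∑ i, D Ω i ⟨D Ω i ⟨u, hu⟩, hu' i⟩), ⟨hu, fun φ hφ => ?_⟩, rfl⟩
  have h1 : ∀ i, ∫ x in Ω, pd i φ x • D Ω i ⟨u, hu⟩ x
      = - ∫ x in Ω, φ x • D Ω i ⟨D Ω i ⟨u, hu⟩, hu' i⟩ x :=
    fun i => D_spec hΩ i ⟨D Ω i ⟨u, hu⟩, hu' i⟩ φ hφ
  have h2 : ∀ s : Finset (Fin d), ∀ f : Fin d → L2 Ω,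
      ∫ x in Ω, φ x • (∑ i ∈ s, f i : L2 Ω) x = ∑ i ∈ s, ∫ x in Ω, φ x • f i x := by
    intro s f
    induction s using Finset.induction_on with
    | empty => simp only [Finset.sum_empty, integral_smul_zero]
    | insert i s his ih => rw [Finset.sum_insert his, integral_smul_add hφ, ih,
        Finset.sum_insert his]
  simp only [h1, h2, Finset.sum_neg_distrib]

/-! ## The energy space and the operator -/

/-- The weight `μ(ξ) = |ξ|^{(2α-d)/2}`. -/
def mu (α : ℝ) (ξ : E d) : ℝ := ‖ξ‖ ^ ((2 * α - d) / 2)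

/-- The constant `κ(α,d) = 2 sin(απ) Γ(d/2+1) / (d π^{d/2+1})`. -/
def kappa (α : ℝ) (d : ℕ) : ℝ :=
  2 * Real.sin (α * Real.pi) * Real.Gamma ((d : ℝ) / 2 + 1) /
    (d * Real.pi ^ ((d : ℝ) / 2 + 1))

/-- The energy space `H¹_{Γ₀}(Ω) × L²(Ω) × H¹_0(Ω) × L²(Ω) × L²(Γ₁ × ℝ^d)`; its norm is
`energyNorm` below (not the norm that Lean attaches to a product). -/
abbrev EnergySpace (Ω Γ₀ Γ₁ : Set (E d)) : Type :=
  H1Γ₀ Ω Γ₀ × L2 Ω × H10 Ω × L2 Ω × L2aux Ω Γ₁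

/-- The inner product of the energy space (linear in the first argument):
`∫_Ω (v ṽ* + ∇u·∇ũ* + z z̃* + a ∇y·∇ỹ*) dx + γ κ(α,d) ∫_{Γ₁} ∫_{ℝ^d} w w̃* dξ dΓ`. -/
def energyInner (Ω Γ₀ Γ₁ : Set (E d)) (a γ α : ℝ) :
    EnergySpace Ω Γ₀ Γ₁ → EnergySpace Ω Γ₀ Γ₁ → ℂ
  | (u, v, y, z, w), (u', v', y', z', w') =>
    inner ℂ v' v + ∑ i, inner ℂ (DΓ₀ Ω Γ₀ i u') (DΓ₀ Ω Γ₀ i u)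
      + inner ℂ z' z + a * ∑ i, inner ℂ (D0 Ω i y') (D0 Ω i y)
      + γ * kappa α d * inner ℂ w' w

/-- The norm of the energy space. -/
def energyNorm (Ω Γ₀ Γ₁ : Set (E d)) (a γ α : ℝ) (U : EnergySpace Ω Γ₀ Γ₁) : ℝ :=
  Real.sqrt (energyInner Ω Γ₀ Γ₁ a γ α U U).re

/-- The function `(x, ξ) ↦ -(|ξ|² + η) w(x,ξ) + τ(x) μ(ξ)` on `Γ₁ × ℝ^d`. -/
def auxFun {Ω Γ₁ : Set (E d)} (η α : ℝ) (τ : L2bd Ω) (w : L2aux Ω Γ₁) (p : E d × E d) : ℂ :=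
  -((‖p.2‖ ^ 2 + η : ℝ) : ℂ) * w p + τ p.1 * (mu α p.2 : ℂ)

lemma auxFun_add {Ω Γ₁ : Set (E d)} (η α : ℝ) (τ τ' : L2bd Ω) (w w' : L2aux Ω Γ₁) :
    auxFun η α (τ + τ') (w + w') =ᵐ[surfProd Ω Γ₁] auxFun η α τ w + auxFun η α τ' w' := by
  have h1 := (Measure.quasiMeasurePreserving_fst (μ := (surf Ω).restrict Γ₁)
    (ν := (volume : Measure (E d)))).ae (ae_restrict_of_ae (Lp.coeFn_add τ τ'))
  filter_upwards [h1, Lp.coeFn_add w w'] with p h1 h2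
  rw [Pi.add_apply, auxFun, auxFun, auxFun, h1, h2, Pi.add_apply, Pi.add_apply]
  ring

lemma auxFun_smul {Ω Γ₁ : Set (E d)} (η α : ℝ) (c : ℂ) (τ : L2bd Ω) (w : L2aux Ω Γ₁) :
    auxFun η α (c • τ) (c • w) =ᵐ[surfProd Ω Γ₁] c • auxFun η α τ w := by
  have h1 := (Measure.quasiMeasurePreserving_fst (μ := (surf Ω).restrict Γ₁)
    (ν := (volume : Measure (E d)))).ae (ae_restrict_of_ae (Lp.coeFn_smul c τ))
  filter_upwards [h1, Lp.coeFn_smul c w] with p h1 h2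
  rw [Pi.smul_apply, auxFun, auxFun, h1, h2, Pi.smul_apply, Pi.smul_apply]
  simp only [smul_eq_mul]
  ring

lemma auxFun_zero {Ω Γ₁ : Set (E d)} (η α : ℝ) :
    auxFun η α (0 : L2bd Ω) (0 : L2aux Ω Γ₁) =ᵐ[surfProd Ω Γ₁] 0 := by
  have h := auxFun_smul η α 0 (0 : L2bd Ω) (0 : L2aux Ω Γ₁)
  rwa [smul_zero, smul_zero, zero_smul] at h

/-- `g + γ κ(α,d) ∫_{ℝ^d} μ(ξ) w(·,ξ) dξ = 0` on `Γ₁`, the integral being absolutely convergent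
(which is automatic when `w` and `|ξ| w` are in `L²(Γ₁ × ℝ^d)`). -/
def FluxCondition {Ω Γ₁ : Set (E d)} (γ α : ℝ) (g : L2bd₁ Ω Γ₁) (w : L2aux Ω Γ₁) : Prop :=
  ∀ᵐ x ∂((surf Ω).restrict Γ₁), Integrable (fun ξ : E d => (mu α ξ : ℂ) * w (x, ξ)) ∧
    g x + γ * kappa α d * ∫ ξ : E d, (mu α ξ : ℂ) * w (x, ξ) = 0

lemma FluxCondition.add {Ω Γ₁ : Set (E d)} {γ α : ℝ} {g g' : L2bd₁ Ω Γ₁} {w w' : L2aux Ω Γ₁}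
    (h : FluxCondition γ α g w) (h' : FluxCondition γ α g' w') :
    FluxCondition γ α (g + g') (w + w') := by
  have h1 : ∀ᵐ x ∂((surf Ω).restrict Γ₁), ∀ᵐ ξ : E d, (w + w' : L2aux Ω Γ₁) (x, ξ)
      = w (x, ξ) + w' (x, ξ) := Measure.ae_ae_of_ae_prod (Lp.coeFn_add w w')
  filter_upwards [h, h', h1, Lp.coeFn_add g g'] with x hx hx' hx1 hg
  have e : (fun ξ : E d => (mu α ξ : ℂ) * (w + w' : L2aux Ω Γ₁) (x, ξ)) =ᵐ[volume]
      fun ξ => (mu α ξ : ℂ) * w (x, ξ) + (mu α ξ : ℂ) * w' (x, ξ) := by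
    filter_upwards [hx1] with ξ hξ
    rw [hξ, mul_add]
  refine ⟨(hx.1.add hx'.1).congr e.symm, ?_⟩
  rw [integral_congr_ae e, integral_add hx.1 hx'.1, hg, Pi.add_apply]
  linear_combination hx.2 + hx'.2

lemma FluxCondition.smul {Ω Γ₁ : Set (E d)} {γ α : ℝ} {g : L2bd₁ Ω Γ₁} {w : L2aux Ω Γ₁} (c : ℂ)
    (h : FluxCondition γ α g w) : FluxCondition γ α (c • g) (c • w) := by
  have h1 : ∀ᵐ x ∂((surf Ω).restrict Γ₁), ∀ᵐ ξ : E d, (c • w : L2aux Ω Γ₁) (x, ξ)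
      = c • w (x, ξ) := Measure.ae_ae_of_ae_prod (Lp.coeFn_smul c w)
  filter_upwards [h, h1, Lp.coeFn_smul c g] with x hx hx1 hg
  have e : (fun ξ : E d => (mu α ξ : ℂ) * (c • w : L2aux Ω Γ₁) (x, ξ)) =ᵐ[volume]
      fun ξ => c * ((mu α ξ : ℂ) * w (x, ξ)) := by
    filter_upwards [hx1] with ξ hξ
    rw [hξ, smul_eq_mul]
    ring
  refine ⟨(hx.1.const_mul c).congr e.symm, ?_⟩
  rw [integral_congr_ae e, integral_const_mul, hg, Pi.smul_apply, smul_eq_mul]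
  linear_combination c * hx.2

lemma FluxCondition.zero {Ω Γ₁ : Set (E d)} {γ α : ℝ} :
    FluxCondition γ α (0 : L2bd₁ Ω Γ₁) (0 : L2aux Ω Γ₁) := by
  have h1 : ∀ᵐ x ∂((surf Ω).restrict Γ₁), ∀ᵐ ξ : E d, (0 : L2aux Ω Γ₁) (x, ξ) = 0 :=
    Measure.ae_ae_of_ae_prod (Lp.coeFn_zero ℂ 2 (surfProd Ω Γ₁))
  filter_upwards [h1, Lp.coeFn_zero ℂ 2 ((surf Ω).restrict Γ₁)] with x hx1 hg
  have e : (fun ξ : E d => (mu α ξ : ℂ) * (0 : L2aux Ω Γ₁) (x, ξ)) =ᵐ[volume] fun _ => (0 : ℂ) := by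
    filter_upwards [hx1] with ξ hξ
    rw [hξ, mul_zero]
  refine ⟨(integrable_zero _ _ _).congr e.symm, ?_⟩
  rw [integral_congr_ae e, hg]
  simp

lemma HasNormalDeriv.add {Ω Γ₀ Γ₁ : Set (E d)} {u u' : H1 Ω} {f f' : L2 Ω} {g g' : L2bd₁ Ω Γ₁}
    (h : HasNormalDeriv Ω Γ₀ Γ₁ u f g) (h' : HasNormalDeriv Ω Γ₀ Γ₁ u' f' g') :
    HasNormalDeriv Ω Γ₀ Γ₁ (u + u') (f + f') (g + g') := by
  intro ψ
  have hτ : MemLp (fun x => star (traceΓ₀ Ω Γ₀ ψ x)) 2 ((surf Ω).restrict Γ₁) :=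
    ((Lp.memLp (traceΓ₀ Ω Γ₀ ψ)).restrict Γ₁).star
  have hi : ∀ k : L2bd₁ Ω Γ₁, Integrable (fun x => k x * star (traceΓ₀ Ω Γ₀ ψ x))
      ((surf Ω).restrict Γ₁) := fun k => MemLp.integrable_mul (Lp.memLp k) hτ
  have e : ∫ x in Γ₁, (g + g' : L2bd₁ Ω Γ₁) x * star (traceΓ₀ Ω Γ₀ ψ x) ∂(surf Ω)
      = ∫ x in Γ₁, (g x * star (traceΓ₀ Ω Γ₀ ψ x) + g' x * star (traceΓ₀ Ω Γ₀ ψ x))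
        ∂(surf Ω) := by
    apply integral_congr_ae
    filter_upwards [Lp.coeFn_add g g'] with x hx
    rw [hx, Pi.add_apply, add_mul]
  rw [e, integral_add (hi g) (hi g'), ← h ψ, ← h' ψ]
  simp only [map_add, inner_add_right, Finset.sum_add_distrib]
  ring

lemma HasNormalDeriv.smul {Ω Γ₀ Γ₁ : Set (E d)} {u : H1 Ω} {f : L2 Ω} {g : L2bd₁ Ω Γ₁} (c : ℂ)
    (h : HasNormalDeriv Ω Γ₀ Γ₁ u f g) :
    HasNormalDeriv Ω Γ₀ Γ₁ (c • u) (c • f) (c • g) := by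
  intro ψ
  have e : ∫ x in Γ₁, (c • g : L2bd₁ Ω Γ₁) x * star (traceΓ₀ Ω Γ₀ ψ x) ∂(surf Ω)
      = ∫ x in Γ₁, c * (g x * star (traceΓ₀ Ω Γ₀ ψ x)) ∂(surf Ω) := by
    apply integral_congr_ae
    filter_upwards [Lp.coeFn_smul c g] with x hx
    rw [hx, Pi.smul_apply, smul_eq_mul, mul_assoc]
  rw [e, integral_const_mul, ← h ψ]
  simp only [map_smul, inner_smul_right, ← Finset.mul_sum]
  ring

lemma HasNormalDeriv.zero {Ω Γ₀ Γ₁ : Set (E d)} :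
    HasNormalDeriv Ω Γ₀ Γ₁ (0 : H1 Ω) (0 : L2 Ω) (0 : L2bd₁ Ω Γ₁) := by
  intro ψ
  have e : ∫ x in Γ₁, (0 : L2bd₁ Ω Γ₁) x * star (traceΓ₀ Ω Γ₀ ψ x) ∂(surf Ω) = 0 := by
    apply integral_eq_zero_of_ae
    filter_upwards [Lp.coeFn_zero ℂ 2 ((surf Ω).restrict Γ₁)] with x hx
    rw [hx]
    simp
  rw [e]
  simp only [map_zero, inner_zero_right, Finset.sum_const_zero, add_zero]

/-- The domain of the operator: all `U = (u, v, y, z, w)` in the energy space with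
* `Δu ∈ L²(Ω)`, `y ∈ H²(Ω) ∩ H¹_0(Ω)` (so that `Δy ∈ L²(Ω)`),
* `v ∈ H¹_{Γ₀}(Ω)`, `z ∈ H¹_0(Ω)`,
* `-(|ξ|² + η) w + v|_{Γ₁} μ(ξ) ∈ L²(Γ₁ × ℝ^d)`, `|ξ| w ∈ L²(Γ₁ × ℝ^d)`,
* `∂u/∂ν + γ κ(α,d) ∫_{ℝ^d} μ(ξ) w(·,ξ) dξ = 0` on `Γ₁`. -/
def domA (Ω Γ₀ Γ₁ : Set (E d)) (γ α η : ℝ) : Submodule ℂ (EnergySpace Ω Γ₀ Γ₁) where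
  carrier := {U | ∃ (hu : (U.1 : L2 Ω) ∈ (lap Ω).domain) (hv : U.2.1 ∈ H1Γ₀ Ω Γ₀),
    (U.2.2.1 : L2 Ω) ∈ (lap Ω).domain ∧ (U.2.2.1 : L2 Ω) ∈ H2 Ω ∧ U.2.2.2.1 ∈ H10 Ω ∧
    MemLp (auxFun η α (traceΓ₀ Ω Γ₀ ⟨U.2.1, hv⟩) U.2.2.2.2) 2 (surfProd Ω Γ₁) ∧
    MemLp (fun p : E d × E d => (‖p.2‖ : ℂ) * U.2.2.2.2 p) 2 (surfProd Ω Γ₁) ∧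
    ∃ g : L2bd₁ Ω Γ₁,
      HasNormalDeriv Ω Γ₀ Γ₁ (Submodule.inclusion (H1Γ₀_le_H1 Ω Γ₀) U.1) (lap Ω ⟨U.1, hu⟩) g ∧
      FluxCondition γ α g U.2.2.2.2}
  zero_mem' := by
    refine ⟨zero_mem _, zero_mem _, zero_mem _, zero_mem _, zero_mem _, ?_, ?_, 0, ?_, ?_⟩
    · have h : traceΓ₀ Ω Γ₀ ⟨(0 : EnergySpace Ω Γ₀ Γ₁).2.1, zero_mem _⟩ = 0 :=
        map_zero (traceΓ₀ Ω Γ₀)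
      rw [h]
      exact (MemLp.zero (p := 2)).ae_eq (auxFun_zero η α).symm
    · refine (MemLp.zero (p := 2)).ae_eq ?_
      filter_upwards [Lp.coeFn_zero ℂ 2 (surfProd Ω Γ₁)] with p hp
      have h : (0 : EnergySpace Ω Γ₀ Γ₁).2.2.2.2 = 0 := rfl
      rw [h, hp]
      simp
    · have h1 : lap Ω ⟨((0 : EnergySpace Ω Γ₀ Γ₁).1 : L2 Ω), zero_mem _⟩ = 0 :=
        LinearPMap.map_zero (lap Ω)
      rw [h1]
      have h := HasNormalDeriv.zero (Ω := Ω) (Γ₀ := Γ₀) (Γ₁ := Γ₁)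
      exact h
    · exact FluxCondition.zero
  add_mem' := by
    rintro U V hU hV
    obtain ⟨hu, hv, hy, hy2, hz, h1, h2, g, hn, hg⟩ := hU
    obtain ⟨ku, kv, ky, ky2, kz, k1, k2, k, kn, kg⟩ := hV
    refine ⟨add_mem hu ku, add_mem hv kv, add_mem hy ky, add_mem hy2 ky2, add_mem hz kz, ?_, ?_,
      g + k, ?_, ?_⟩
    · have h : traceΓ₀ Ω Γ₀ ⟨(U + V).2.1, add_mem hv kv⟩
          = traceΓ₀ Ω Γ₀ ⟨U.2.1, hv⟩ + traceΓ₀ Ω Γ₀ ⟨V.2.1, kv⟩ :=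
        map_add (traceΓ₀ Ω Γ₀) ⟨U.2.1, hv⟩ ⟨V.2.1, kv⟩
      rw [h]
      exact (h1.add k1).ae_eq (auxFun_add η α _ _ _ _).symm
    · refine (h2.add k2).ae_eq ?_
      filter_upwards [Lp.coeFn_add U.2.2.2.2 V.2.2.2.2] with p hp
      have h : (U + V).2.2.2.2 = U.2.2.2.2 + V.2.2.2.2 := rfl
      rw [h, hp, Pi.add_apply, Pi.add_apply, mul_add]
    · have h : lap Ω ⟨((U + V).1 : L2 Ω), add_mem hu ku⟩ = lap Ω ⟨U.1, hu⟩ + lap Ω ⟨V.1, ku⟩ :=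
        LinearPMap.map_add (lap Ω) ⟨U.1, hu⟩ ⟨V.1, ku⟩
      rw [h]
      have h' := HasNormalDeriv.add hn kn
      exact h'
    · exact hg.add kg
  smul_mem' := by
    rintro c U hU
    obtain ⟨hu, hv, hy, hy2, hz, h1, h2, g, hn, hg⟩ := hU
    refine ⟨Submodule.smul_mem _ c hu, Submodule.smul_mem _ c hv, Submodule.smul_mem _ c hy,
      Submodule.smul_mem _ c hy2, Submodule.smul_mem _ c hz, ?_, ?_, c • g, ?_, ?_⟩
    · have h : traceΓ₀ Ω Γ₀ ⟨(c • U).2.1, Submodule.smul_mem _ c hv⟩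
          = c • traceΓ₀ Ω Γ₀ ⟨U.2.1, hv⟩ := map_smul (traceΓ₀ Ω Γ₀) c ⟨U.2.1, hv⟩
      rw [h]
      exact (h1.const_smul c).ae_eq (auxFun_smul η α c _ _).symm
    · refine (h2.const_smul c).ae_eq ?_
      filter_upwards [Lp.coeFn_smul c U.2.2.2.2] with p hp
      have h : (c • U).2.2.2.2 = c • U.2.2.2.2 := rfl
      rw [h, hp, Pi.smul_apply, Pi.smul_apply, smul_eq_mul, smul_eq_mul]
      ring
    · have h : lap Ω ⟨((c • U).1 : L2 Ω), Submodule.smul_mem _ c hu⟩ = c • lap Ω ⟨U.1, hu⟩ :=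
        LinearPMap.map_smul (lap Ω) c ⟨U.1, hu⟩
      rw [h]
      have h' := HasNormalDeriv.smul c hn
      exact h'
    · exact hg.smul c

lemma domA_u {Ω Γ₀ Γ₁ : Set (E d)} {γ α η : ℝ} {U : EnergySpace Ω Γ₀ Γ₁}
    (h : U ∈ domA Ω Γ₀ Γ₁ γ α η) : (U.1 : L2 Ω) ∈ (lap Ω).domain := h.choose

lemma domA_v {Ω Γ₀ Γ₁ : Set (E d)} {γ α η : ℝ} {U : EnergySpace Ω Γ₀ Γ₁}
    (h : U ∈ domA Ω Γ₀ Γ₁ γ α η) : U.2.1 ∈ H1Γ₀ Ω Γ₀ := h.choose_spec.choose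

lemma domA_y {Ω Γ₀ Γ₁ : Set (E d)} {γ α η : ℝ} {U : EnergySpace Ω Γ₀ Γ₁}
    (h : U ∈ domA Ω Γ₀ Γ₁ γ α η) : (U.2.2.1 : L2 Ω) ∈ (lap Ω).domain :=
  h.choose_spec.choose_spec.1

lemma domA_z {Ω Γ₀ Γ₁ : Set (E d)} {γ α η : ℝ} {U : EnergySpace Ω Γ₀ Γ₁}
    (h : U ∈ domA Ω Γ₀ Γ₁ γ α η) : U.2.2.2.1 ∈ H10 Ω := h.choose_spec.choose_spec.2.2.1

lemma domA_w {Ω Γ₀ Γ₁ : Set (E d)} {γ α η : ℝ} {U : EnergySpace Ω Γ₀ Γ₁}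
    (h : U ∈ domA Ω Γ₀ Γ₁ γ α η) :
    MemLp (auxFun η α (traceΓ₀ Ω Γ₀ ⟨U.2.1, domA_v h⟩) U.2.2.2.2) 2 (surfProd Ω Γ₁) :=
  h.choose_spec.choose_spec.2.2.2.1

/-- The operator
`A (u, v, y, z, w) = (v, Δu - b z, z, a Δy + b v, -(|ξ|² + η) w + v|_{Γ₁} μ(ξ))`. -/
def opA (Ω Γ₀ Γ₁ : Set (E d)) (a b γ α η : ℝ) :
    EnergySpace Ω Γ₀ Γ₁ →ₗ.[ℂ] EnergySpace Ω Γ₀ Γ₁ where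
  domain := domA Ω Γ₀ Γ₁ γ α η
  toFun :=
    { toFun := fun U =>
        (⟨U.1.2.1, domA_v U.2⟩,
          lap Ω ⟨U.1.1, domA_u U.2⟩ - (b : ℂ) • U.1.2.2.2.1,
          ⟨U.1.2.2.2.1, domA_z U.2⟩,
          (a : ℂ) • lap Ω ⟨U.1.2.2.1, domA_y U.2⟩ + (b : ℂ) • U.1.2.1,
          (domA_w U.2).toLp)
      map_add' := by
        intro U V
        refine Prod.ext rfl (Prod.ext ?_ (Prod.ext rfl (Prod.ext ?_ ?_)))
        · have h : lap Ω ⟨(U + V).1.1, domA_u (U + V).2⟩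
              = lap Ω ⟨U.1.1, domA_u U.2⟩ + lap Ω ⟨V.1.1, domA_u V.2⟩ :=
            LinearPMap.map_add (lap Ω) ⟨U.1.1, domA_u U.2⟩ ⟨V.1.1, domA_u V.2⟩
          have h' : (U + V).1.2.2.2.1 = U.1.2.2.2.1 + V.1.2.2.2.1 := rfl
          simp only [Prod.snd_add, Prod.fst_add, h, h', smul_add]
          abel
        · have h : lap Ω ⟨(U + V).1.2.2.1, domA_y (U + V).2⟩
              = lap Ω ⟨U.1.2.2.1, domA_y U.2⟩ + lap Ω ⟨V.1.2.2.1, domA_y V.2⟩ :=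
            LinearPMap.map_add (lap Ω) ⟨U.1.2.2.1, domA_y U.2⟩ ⟨V.1.2.2.1, domA_y V.2⟩
          have h' : (U + V).1.2.1 = U.1.2.1 + V.1.2.1 := rfl
          simp only [Prod.snd_add, Prod.fst_add, h, h', smul_add]
          abel
        · have h : traceΓ₀ Ω Γ₀ ⟨(U + V).1.2.1, domA_v (U + V).2⟩
              = traceΓ₀ Ω Γ₀ ⟨U.1.2.1, domA_v U.2⟩ + traceΓ₀ Ω Γ₀ ⟨V.1.2.1, domA_v V.2⟩ :=
            map_add (traceΓ₀ Ω Γ₀) ⟨U.1.2.1, domA_v U.2⟩ ⟨V.1.2.1, domA_v V.2⟩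
          simp only [Prod.snd_add]
          rw [← MemLp.toLp_add, MemLp.toLp_eq_toLp_iff, h]
          exact auxFun_add η α _ _ _ _
      map_smul' := by
        intro c U
        refine Prod.ext rfl (Prod.ext ?_ (Prod.ext rfl (Prod.ext ?_ ?_)))
        · have h : lap Ω ⟨(c • U).1.1, domA_u (c • U).2⟩ = c • lap Ω ⟨U.1.1, domA_u U.2⟩ :=
            LinearPMap.map_smul (lap Ω) c ⟨U.1.1, domA_u U.2⟩
          have h' : (c • U).1.2.2.2.1 = c • U.1.2.2.2.1 := rfl
          simp only [Prod.smul_snd, Prod.smul_fst, h, h', smul_sub, RingHom.id_apply]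
          rw [smul_comm]
        · have h : lap Ω ⟨(c • U).1.2.2.1, domA_y (c • U).2⟩
              = c • lap Ω ⟨U.1.2.2.1, domA_y U.2⟩ :=
            LinearPMap.map_smul (lap Ω) c ⟨U.1.2.2.1, domA_y U.2⟩
          have h' : (c • U).1.2.1 = c • U.1.2.1 := rfl
          simp only [Prod.smul_snd, Prod.smul_fst, h, h', smul_add, RingHom.id_apply]
          rw [smul_comm c (a : ℂ), smul_comm c (b : ℂ)]
        · have h : traceΓ₀ Ω Γ₀ ⟨(c • U).1.2.1, domA_v (c • U).2⟩
              = c • traceΓ₀ Ω Γ₀ ⟨U.1.2.1, domA_v U.2⟩ :=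
            map_smul (traceΓ₀ Ω Γ₀) c ⟨U.1.2.1, domA_v U.2⟩
          simp only [Prod.smul_snd, RingHom.id_apply]
          rw [← MemLp.toLp_const_smul, MemLp.toLp_eq_toLp_iff, h]
          exact auxFun_smul η α c _ _ }

/-! ## Invertibility and spectrum of unbounded operators -/

/-- An unbounded operator `T` on a space with norm `N` is (boundedly) invertible: it is a bijection
from its domain onto the whole space and its inverse is bounded. -/
def IsInvertible {H : Type*} [AddCommGroup H] [Module ℂ H] (N : H → ℝ) (T : H →ₗ.[ℂ] H) : Prop :=
  Function.Bijective (fun U : T.domain => T U) ∧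
    ∃ C : ℝ, ∀ U : T.domain, N (U : H) ≤ C * N (T U)

/-- The operator `l I - T`, with the domain of `T`. -/
def shift {H : Type*} [AddCommGroup H] [Module ℂ H] (l : ℂ) (T : H →ₗ.[ℂ] H) : H →ₗ.[ℂ] H :=
  (l • LinearMap.id : H →ₗ[ℂ] H) +ᵥ (-T)

/-- The spectrum of an unbounded operator `T` on a space with norm `N`: the set of all `l` for
which `l I - T` is not invertible. -/
def spectrumOf {H : Type*} [AddCommGroup H] [Module ℂ H] (N : H → ℝ) (T : H →ₗ.[ℂ] H) : Set ℂ :=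
  {l | ¬ IsInvertible N (shift l T)}

end CoupledWave

end

noncomputable section

namespace CoupledWave

variable {d : ℕ}

/-! ## Surface measure in a Lipschitz chart -/

/-! With `η = 0`, the equation `-A U = (φ, 0, 0, 0, 0)` can be solved explicitly in two of its
components. The first gives `v = -φ`, and the last gives `|ξ|² ω = v μ(ξ)`, hence `ω =
-|ξ|^((2α-d-4)/2) φ|_Γ₁`. By Tonelli, the squared `L²` norm of this `ω` is `∫_Γ₁ |φ|² dΓ` times `∫
|ξ|^(2α-d-4) dξ`. The second factor diverges at the origin because `2α - 4 < 0`, and the first is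
nonzero when the trace of `φ` is. So no `U` in the energy space exists, surjectivity fails whatever
the norm, and `0 · I - A = -A` puts `0` in the spectrum. This part rests on `memLp_of_neg_opA_eq`,
`not_memLp_norm_rpow_mul` and `not_integrable_norm_rpow`.

The longer part is to exhibit `φ ∈ H¹_Γ₀(Ω)` with nonzero trace on `Γ₁`
(`IsAdmissible.exists_traceΓ₀_ne_zero`). A bump at a point of `Γ₁`, supported off the closure of
`Γ₀`, should do, but two facts about the boundary are needed. First, relatively open pieces of `Γ`
have positive surface measure (`surf_pos`). Second, the trace of a smooth function must be its
restriction. The trace is read off from a closed graph, and `Submodule.toLinearPMap` is the zero map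
on its domain unless that graph is single valued. Single-valuedness (`traceGraph_unique`) follows
from a local `W^{1,1}` trace inequality in Lipschitz charts (`IsLipschitzChart.exists_trace_le`). -/

/-- The Euclidean normalisation multiplies the Hausdorff measure by a constant depending only on
`n`, hence by the same one in `X` and `Y`. Applied to graph maps it bounds surface measure from
above; applied to projections, from below. -/
lemma euclideanHausdorffMeasure_image_le {X Y : Type*} [EMetricSpace X] [MeasurableSpace X]
    [BorelSpace X] [EMetricSpace Y] [MeasurableSpace Y] [BorelSpace Y] {K : NNReal} {f : X → Y}
    (hf : LipschitzWith K f) (n : ℕ) (s : Set X) :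
    (Measure.euclideanHausdorffMeasure n : Measure Y) (f '' s)
      ≤ (K : ℝ≥0∞) ^ n * (Measure.euclideanHausdorffMeasure n : Measure X) s := by
  simp only [Measure.euclideanHausdorffMeasure_def, Measure.smul_apply, ENNReal.smul_def,
    smul_eq_mul]
  have h := hf.hausdorffMeasure_image_le (d := n) (by positivity) s
  rw [ENNReal.rpow_natCast] at h
  rw [mul_left_comm]
  gcongr

/-- A boundary chart of `Ω` at `x`: inside `ball x r`, the set `Ω` is the strict epigraph, in the
unit direction `e`, of the Lipschitz function `h`. -/
structure IsLipschitzChart (Ω : Set (E d)) (x e : E d) (h : E d → ℝ) (K : NNReal) (r : ℝ) :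
    Prop where
  norm_eq : ‖e‖ = 1
  lipschitz : LipschitzWith K h
  pos : 0 < r
  mem_iff : ∀ y ∈ Metric.ball x r, (y ∈ Ω ↔ h (y - inner ℝ e y • e) < inner ℝ e y)

/-- The hyperplane orthogonal to `e`. -/
abbrev perp (e : E d) : Submodule ℝ (E d) := (Submodule.span ℝ {e})ᗮ

/-- The orthogonal projection onto the hyperplane orthogonal to `e`. -/
def prj (e : E d) : E d →L[ℝ] perp e := (perp e).orthogonalProjectionOnto

/-- The graph parametrisation `v ↦ v + h(v) e` over the hyperplane orthogonal to `e`. -/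
def graphMap (e : E d) (h : E d → ℝ) (v : perp e) : E d := v + h v • e

/-- The `(d-1)`-dimensional measure on the hyperplane orthogonal to `e`. -/
def perpMeasure (e : E d) : Measure (perp e) := Measure.euclideanHausdorffMeasure (d - 1)

lemma finrank_perp {e : E d} (he : ‖e‖ = 1) : Module.finrank ℝ (perp e) = d - 1 := by
  have h0 : e ≠ 0 := by rintro rfl; simp at he
  have h1 : _ + Module.finrank ℝ (perp e) = _ :=
    (Submodule.span ℝ {e}).finrank_add_finrank_orthogonal
  rw [finrank_span_singleton h0, finrank_euclideanSpace_fin] at h1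
  omega

/-- The exponent `d - 1` is the true dimension of the hyperplane. The Haar property supplies
finiteness on bounded sets, positivity on nonempty open sets and uniqueness up to a factor. -/
lemma isAddHaarMeasure_perpMeasure {e : E d} (he : ‖e‖ = 1) :
    (perpMeasure e).IsAddHaarMeasure := by
  rw [perpMeasure, ← finrank_perp he]
  infer_instance

lemma coe_prj {e : E d} (he : ‖e‖ = 1) (y : E d) : (prj e y : E d) = y - inner ℝ e y • e := by
  rw [← Submodule.starProjection_unit_singleton ℝ he y, prj, ← Submodule.starProjection_apply]
  exact Submodule.starProjection_orthogonal_val y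

lemma inner_perp (e : E d) (v : perp e) : inner ℝ e (v : E d) = 0 :=
  Submodule.mem_orthogonal_singleton_iff_inner_right.1 v.2

lemma inner_add_smul {e : E d} (he : ‖e‖ = 1) (v : perp e) (t : ℝ) :
    inner ℝ e ((v : E d) + t • e) = t := by
  rw [inner_add_right, inner_perp, inner_smul_right, real_inner_self_eq_norm_sq, he]
  simp

lemma prj_add_smul {e : E d} (he : ‖e‖ = 1) (v : perp e) (t : ℝ) :
    prj e ((v : E d) + t • e) = v := by
  apply Subtype.ext
  rw [coe_prj he, inner_add_smul he]
  simp

lemma prj_add_inner {e : E d} (he : ‖e‖ = 1) (y : E d) :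
    (prj e y : E d) + (inner ℝ e y : ℝ) • e = y := by
  rw [coe_prj he]; simp

lemma lipschitzWith_prj (e : E d) : LipschitzWith 1 (prj e) :=
  (perp e).lipschitzWith_orthogonalProjectionOnto

lemma lipschitzWith_graphMap {e : E d} (he : ‖e‖ = 1) {h : E d → ℝ} {K : NNReal}
    (hh : LipschitzWith K h) : LipschitzWith (1 + K) (graphMap e h) := by
  have h1 : LipschitzWith 1 (fun v : perp e => (v : E d)) := LipschitzWith.subtype_val _
  have h2 : LipschitzWith K (fun v : perp e => h v • e) := by
    refine LipschitzWith.of_dist_le_mul fun v w => ?_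
    rw [dist_eq_norm, ← sub_smul, norm_smul, he, mul_one, ← dist_eq_norm]
    exact hh.dist_le_mul v w
  exact h1.add h2

/-- As `Ω` is open, its frontier is its closure minus itself. Points strictly below the graph have a
neighbourhood missing `Ω`, and points on the graph are limits of `y + t • e ∈ Ω` as `t` decreases to
`0`. -/
lemma IsLipschitzChart.mem_frontier_iff {Ω : Set (E d)} {x e : E d} {h : E d → ℝ} {K : NNReal}
    {r : ℝ} (hc : IsLipschitzChart Ω x e h K r) (hΩ : IsOpen Ω) {y : E d}
    (hy : y ∈ Metric.ball x r) : y ∈ frontier Ω ↔ graphMap e h (prj e y) = y := by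
  have hg : graphMap e h (prj e y) = y ↔ h (y - inner ℝ e y • e) = inner ℝ e y := by
    constructor
    · intro hy
      have h1 := congrArg (inner ℝ e) hy
      rwa [graphMap, inner_add_smul hc.norm_eq, coe_prj hc.norm_eq] at h1
    · intro hy
      rw [graphMap, coe_prj hc.norm_eq, hy]
      simp
  rw [hg, hΩ.frontier_eq]
  have hcont : Continuous fun z : E d => h (z - inner ℝ e z • e) - inner ℝ e z := by
    have := hc.lipschitz.continuous
    fun_prop
  constructor
  · rintro ⟨h1, h2⟩
    rw [hc.mem_iff y hy, not_lt] at h2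
    refine le_antisymm (not_lt.1 fun h3 => ?_) h2
    have h4 : ∀ᶠ z in 𝓝 y, 0 < h (z - inner ℝ e z • e) - inner ℝ e z :=
      hcont.continuousAt.eventually (lt_mem_nhds (sub_pos.2 h3))
    obtain ⟨z, ⟨hz1, hz2⟩, hz3⟩ := mem_closure_iff_nhds.1 h1 _
      (Filter.inter_mem h4 (Metric.isOpen_ball.mem_nhds hy))
    have h5 := (hc.mem_iff z hz2).1 hz3
    have h6 : 0 < h (z - inner ℝ e z • e) - inner ℝ e z := hz1
    linarith
  · intro h1
    refine ⟨?_, fun h2 => ((hc.mem_iff y hy).1 h2).ne h1⟩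
    have ht : Tendsto (fun t : ℝ => y + t • e) (𝓝[>] 0) (𝓝 y) := by
      have : Continuous fun t : ℝ => y + t • e := by fun_prop
      simpa using (this.tendsto 0).mono_left nhdsWithin_le_nhds
    refine mem_closure_of_tendsto ht ?_
    filter_upwards [ht (Metric.isOpen_ball.mem_nhds hy), self_mem_nhdsWithin] with t ht1 ht2
    rw [hc.mem_iff _ ht1]
    have h3 : (inner ℝ e (y + t • e) : ℝ) = inner ℝ e y + t := by
      rw [inner_add_right, inner_smul_right, real_inner_self_eq_norm_sq, hc.norm_eq]
      simp
    have h4 : y + t • e - (inner ℝ e (y + t • e) : ℝ) • e = y - inner ℝ e y • e := by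
      rw [h3, add_smul]; abel
    rw [h4, h3, h1]
    exact lt_add_of_pos_right _ ht2

lemma IsLipschitzChart.graphMap_add_mem {Ω : Set (E d)} {x e : E d} {h : E d → ℝ} {K : NNReal}
    {r : ℝ} (hc : IsLipschitzChart Ω x e h K r) {v : perp e} {t : ℝ} (ht : 0 < t)
    (hv : graphMap e h v + t • e ∈ Metric.ball x r) : graphMap e h v + t • e ∈ Ω := by
  rw [hc.mem_iff _ hv, graphMap, add_assoc, ← add_smul, inner_add_smul hc.norm_eq,
    add_sub_cancel_right]
  exact lt_add_of_pos_right _ ht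

/-- The boundary inside the chart lies in the image of the graph map, which is `(1 + K)`-Lipschitz.
This converts surface integrals into integrals over a hyperplane. -/
lemma IsLipschitzChart.surf_restrict_le {Ω : Set (E d)} {x e : E d} {h : E d → ℝ} {K : NNReal}
    {r ρ : ℝ} (hc : IsLipschitzChart Ω x e h K r) (hΩ : IsOpen Ω) (hρ : ρ ≤ r) :
    (surf Ω).restrict (Metric.ball x ρ) ≤ ((1 + K : NNReal) : ℝ≥0∞) ^ (d - 1) •
      ((perpMeasure e).restrict (graphMap e h ⁻¹' Metric.ball x ρ)).map (graphMap e h) := by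
  have hG := lipschitzWith_graphMap hc.norm_eq hc.lipschitz
  refine Measure.le_iff.2 fun A hA => ?_
  rw [Measure.restrict_apply hA, surf, Measure.restrict_apply (hA.inter measurableSet_ball),
    Measure.smul_apply, Measure.map_apply hG.continuous.measurable hA,
    Measure.restrict_apply (hG.continuous.measurable hA), smul_eq_mul]
  refine le_trans (measure_mono ?_) (euclideanHausdorffMeasure_image_le hG (d - 1) _)
  rintro y ⟨⟨h1, h2⟩, h3⟩
  have h4 := (hc.mem_frontier_iff hΩ (Metric.ball_subset_ball hρ h2)).1 h3
  refine ⟨prj e y, ⟨?_, ?_⟩, h4⟩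
  · rwa [Set.mem_preimage, h4]
  · rwa [Set.mem_preimage, h4]

lemma IsLipschitzChart.perpMeasure_lt_top {Ω : Set (E d)} {x e : E d} {h : E d → ℝ} {K : NNReal}
    {r : ℝ} (hc : IsLipschitzChart Ω x e h K r) (ρ : ℝ) :
    perpMeasure e (graphMap e h ⁻¹' Metric.ball x ρ) < ⊤ := by
  have := isAddHaarMeasure_perpMeasure hc.norm_eq
  refine Bornology.IsBounded.measure_lt_top ?_
  refine Metric.isBounded_ball.subset (t := Metric.ball (prj e x) ρ) fun v hv => ?_
  have h1 := (lipschitzWith_prj e).dist_le_mul (graphMap e h v) x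
  rw [graphMap, prj_add_smul hc.norm_eq, NNReal.coe_one, one_mul] at h1
  exact h1.trans_lt hv

lemma IsLipschitzChart.surf_ball_lt_top {Ω : Set (E d)} {x e : E d} {h : E d → ℝ} {K : NNReal}
    {r : ℝ} (hc : IsLipschitzChart Ω x e h K r) (hΩ : IsOpen Ω) :
    surf Ω (Metric.ball x r) < ⊤ := by
  have h1 := hc.surf_restrict_le hΩ le_rfl Set.univ
  have hG := lipschitzWith_graphMap hc.norm_eq hc.lipschitz
  rw [Measure.restrict_apply_univ, Measure.smul_apply,
    Measure.map_apply hG.continuous.measurable MeasurableSet.univ, Set.preimage_univ,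
    Measure.restrict_apply_univ, smul_eq_mul] at h1
  exact h1.trans_lt (ENNReal.mul_lt_top (ENNReal.pow_lt_top ENNReal.coe_lt_top)
    (hc.perpMeasure_lt_top r))

lemma HasLipschitzBoundary.exists_chart {Ω : Set (E d)} (hL : HasLipschitzBoundary Ω) {x : E d}
    (hx : x ∈ frontier Ω) : ∃ e h K r, IsLipschitzChart Ω x e h K r := by
  obtain ⟨e, h, K, r, h1, h2, h3, h4⟩ := hL x hx
  exact ⟨e, h, K, r, h1, h2, h3, h4⟩

/-- The boundary is compact and each chart ball has finite surface measure. Finiteness lets `L²(Γ)`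
convergence be weakened to `L¹(Γ)`. -/
lemma isFiniteMeasure_surf {Ω : Set (E d)} (hΩ : IsOpen Ω) (hb : Bornology.IsBounded Ω)
    (hL : HasLipschitzBoundary Ω) : IsFiniteMeasure (surf Ω) := by
  have hK : IsCompact (frontier Ω) :=
    Metric.isCompact_of_isClosed_isBounded isClosed_frontier
      (hb.closure.subset frontier_subset_closure)
  have h1 : surf Ω (frontier Ω) < ⊤ := by
    refine hK.measure_lt_top_of_nhdsWithin fun x hx => ?_
    obtain ⟨e, h, K, r, hc⟩ := hL.exists_chart hx
    exact ⟨Metric.ball x r, mem_nhdsWithin_of_mem_nhds (Metric.ball_mem_nhds x hc.pos),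
      hc.surf_ball_lt_top hΩ⟩
  refine ⟨?_⟩
  have h2 : surf Ω Set.univ = surf Ω (frontier Ω) := by
    rw [surf, Measure.restrict_apply_univ, Measure.restrict_apply_self]
  rwa [h2]

/-- Open sets meeting a Lipschitz boundary have positive surface measure. -/
lemma surf_pos {Ω : Set (E d)} (hΩ : IsOpen Ω) (hL : HasLipschitzBoundary Ω) {O : Set (E d)}
    (hO : IsOpen O) {x : E d} (hx : x ∈ frontier Ω) (hxO : x ∈ O) : 0 < surf Ω O := by
  obtain ⟨e, h, K, r, hc⟩ := hL.exists_chart hx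
  have := isAddHaarMeasure_perpMeasure hc.norm_eq
  have hG := lipschitzWith_graphMap hc.norm_eq hc.lipschitz
  have hU : IsOpen (graphMap e h ⁻¹' (O ∩ Metric.ball x r)) :=
    (hO.inter Metric.isOpen_ball).preimage hG.continuous
  have hxr := Metric.mem_ball_self (x := x) hc.pos
  have hne : (graphMap e h ⁻¹' (O ∩ Metric.ball x r)).Nonempty :=
    ⟨prj e x, by rw [Set.mem_preimage, (hc.mem_frontier_iff hΩ hxr).1 hx]; exact ⟨hxO, hxr⟩⟩
  refine (hU.measure_pos (perpMeasure e) hne).trans_le ?_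
  -- Projection does not increase measure, and the projection of `O ∩ frontier Ω` contains a
  -- nonempty open subset of the hyperplane.
  have h1 := euclideanHausdorffMeasure_image_le (lipschitzWith_prj e) (d - 1) (O ∩ frontier Ω)
  rw [ENNReal.coe_one, one_pow, one_mul] at h1
  rw [surf, Measure.restrict_apply hO.measurableSet]
  refine le_trans (measure_mono ?_) h1
  intro v hv
  have hv' : prj e (graphMap e h v) = v := prj_add_smul hc.norm_eq _ _
  exact ⟨graphMap e h v, ⟨hv.1, (hc.mem_frontier_iff hΩ hv.2).2 (by rw [hv'])⟩, hv'⟩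

/-! ## The trace inequality -/

/-- The decomposition of `ℝ^d` into a hyperplane and its normal line. -/
def perpEquiv {e : E d} (he : ‖e‖ = 1) : (perp e × ℝ) ≃L[ℝ] E d :=
  ContinuousLinearEquiv.equivOfInverse
    ((perp e).subtypeL.coprod (ContinuousLinearMap.toSpanSingleton ℝ e))
    ((prj e).prod (innerSL ℝ e))
    (fun p => Prod.ext (by simpa using prj_add_smul he p.1 p.2)
      (by simpa using inner_add_smul he p.1 p.2))
    (fun y => by simpa using prj_add_inner he y)

lemma perpEquiv_apply {e : E d} (he : ‖e‖ = 1) (p : perp e × ℝ) :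
    perpEquiv he p = (p.1 : E d) + p.2 • e := by
  simp [perpEquiv]

/-- Fubini along `e`: the product measure transports to a Haar measure on `ℝ^d`, so it is a multiple
of Lebesgue measure. The value of the multiple is never needed. -/
lemma exists_lintegral_perp_eq {e : E d} (he : ‖e‖ = 1) : ∃ c : NNReal, ∀ f : E d → ℝ≥0∞,
    Measurable f → ∫⁻ v, (∫⁻ t : ℝ, f ((v : E d) + t • e)) ∂(perpMeasure e) = c * ∫⁻ y, f y := by
  have := isAddHaarMeasure_perpMeasure he
  have := (perpEquiv he).isAddHaarMeasure_map ((perpMeasure e).prod volume)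
  obtain ⟨c, h1⟩ : ∃ c : NNReal,
      ((perpMeasure e).prod volume).map (perpEquiv he) = c • (volume : Measure (E d)) :=
    ⟨_, Measure.isAddLeftInvariant_eq_smul _ volume⟩
  refine ⟨c, fun f hf => ?_⟩
  have hm : Measurable (perpEquiv he) := (perpEquiv he).continuous.measurable
  have h2 : ∫⁻ v, (∫⁻ t : ℝ, f ((v : E d) + t • e)) ∂(perpMeasure e)
      = ∫⁻ y, f y ∂(((perpMeasure e).prod volume).map (perpEquiv he)) := by
    rw [lintegral_map hf hm,
      lintegral_prod (fun p => f (perpEquiv he p)) (hf.comp hm).aemeasurable]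
    simp only [perpEquiv_apply]
  rw [h2, h1, lintegral_smul_measure]
  rfl

/-- Integrating over the part of `Ω` lying within distance `δ`, in direction `e`, of a piece of
the boundary. -/
lemma IsLipschitzChart.exists_lintegral_collar_le {Ω : Set (E d)} {x e : E d} {h : E d → ℝ}
    {K : NNReal} {r : ℝ} (hc : IsLipschitzChart Ω x e h K r) (hΩ : IsOpen Ω) :
    ∃ c : NNReal, ∀ f : E d → ℝ≥0∞, Measurable f →
      ∫⁻ v in graphMap e h ⁻¹' Metric.ball x (r / 2), (∫⁻ t in Set.Ioo 0 (r / 2),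
        f (graphMap e h v + t • e)) ∂(perpMeasure e) ≤ c * ∫⁻ y in Ω, f y := by
  obtain ⟨c, hcc⟩ := exists_lintegral_perp_eq hc.norm_eq
  refine ⟨c, fun f hf => ?_⟩
  have hG := lipschitzWith_graphMap hc.norm_eq hc.lipschitz
  rw [← lintegral_indicator hΩ.measurableSet, ← hcc _ (hf.indicator hΩ.measurableSet)]
  refine (setLIntegral_mono' (hG.continuous.measurable measurableSet_ball) fun v hv => ?_).trans
    (setLIntegral_le_lintegral _ _)
  have hv' : dist (graphMap e h v) x < r / 2 := hv
  calc ∫⁻ t in Set.Ioo 0 (r / 2), f (graphMap e h v + t • e)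
      ≤ ∫⁻ t in Set.Ioo 0 (r / 2), Ω.indicator f ((v : E d) + (h v + t) • e) := by
        refine setLIntegral_mono' measurableSet_Ioo fun t ht => ?_
        -- The base point is within `r / 2` of `x` and the height is below `r / 2`, so the point
        -- stays in the chart ball.
        have hmem : graphMap e h v + t • e ∈ Ω := by
          refine hc.graphMap_add_mem ht.1 ?_
          rw [Metric.mem_ball]
          calc dist (graphMap e h v + t • e) x
              ≤ dist (graphMap e h v + t • e) (graphMap e h v) + dist (graphMap e h v) x :=
                dist_triangle _ _ _
            _ < r / 2 + r / 2 := by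
                rw [dist_self_add_left, norm_smul, hc.norm_eq, mul_one, Real.norm_of_nonneg ht.1.le]
                exact add_lt_add ht.2 hv'
            _ = r := add_halves r
        rw [add_smul, ← add_assoc]
        exact (Set.indicator_of_mem hmem f).ge
    _ ≤ ∫⁻ t, Ω.indicator f ((v : E d) + (h v + t) • e) := setLIntegral_le_lintegral _ _
    -- Translating the line variable by `h v` straightens the graph.
    _ = ∫⁻ t, Ω.indicator f ((v : E d) + t • e) :=
        lintegral_add_left_eq_self (fun t => Ω.indicator f ((v : E d) + t • e)) (h v)

/-- One-dimensional trace inequality along a segment. -/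
lemma mul_enorm_le_lintegral_segment {φ : E d → ℂ} (hφ : ContDiff ℝ ∞ φ) (p e : E d) (δ : ℝ) :
    ENNReal.ofReal δ * ‖φ p‖ₑ ≤ (∫⁻ t in Set.Ioo 0 δ, ‖φ (p + t • e)‖ₑ)
      + ENNReal.ofReal δ * ∫⁻ t in Set.Ioo 0 δ, ‖fderiv ℝ φ (p + t • e) e‖ₑ := by
  have hd : ∀ t : ℝ, HasDerivAt (fun t : ℝ => φ (p + t • e)) (fderiv ℝ φ (p + t • e) e) t := by
    intro t
    have h1 := (hφ.differentiable (by simp) (p + t • e)).hasFDerivAt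
    have h2 : HasDerivAt (fun t : ℝ => p + t • e) e t := by
      simpa using ((hasDerivAt_id t).smul_const e).const_add p
    exact h1.comp_hasDerivAt t h2
  have hc : Continuous fun t : ℝ => fderiv ℝ φ (p + t • e) e := by
    have h1 := hφ.continuous_fderiv (by simp)
    fun_prop
  -- Fundamental theorem of calculus from `p` to `p + s • e`, with the derivative integral enlarged
  -- to the whole segment so that it no longer depends on `s`. Integrating in `s` over `(0, δ)` then
  -- yields the factor `δ`.
  have hs : ∀ s ∈ Set.Ioo 0 δ, ‖φ p‖ₑ ≤ ‖φ (p + s • e)‖ₑ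
      + ∫⁻ t in Set.Ioo 0 δ, ‖fderiv ℝ φ (p + t • e) e‖ₑ := by
    intro s hs
    have h1 := intervalIntegral.integral_eq_sub_of_hasDerivAt (a := 0) (b := s)
      (fun t _ => hd t) (hc.intervalIntegrable _ _)
    rw [zero_smul, add_zero] at h1
    have h2 : φ p = φ (p + s • e) - ∫ t in (0 : ℝ)..s, fderiv ℝ φ (p + t • e) e := by
      rw [h1]; ring
    calc ‖φ p‖ₑ ≤ ‖φ (p + s • e)‖ₑ + ‖∫ t in (0 : ℝ)..s, fderiv ℝ φ (p + t • e) e‖ₑ := by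
          rw [h2]; exact enorm_sub_le
      _ ≤ _ := by
          gcongr
          rw [intervalIntegral.integral_of_le hs.1.le]
          refine (enorm_integral_le_lintegral_enorm _).trans (lintegral_mono_set ?_)
          exact fun t ht => ⟨ht.1, ht.2.trans_lt hs.2⟩
  have hv : volume (Set.Ioo 0 δ) = ENNReal.ofReal δ := by simp
  have h1 := setLIntegral_mono' (μ := volume) measurableSet_Ioo hs
  rw [setLIntegral_const, hv, lintegral_add_right _ measurable_const, setLIntegral_const, hv] at h1
  rwa [mul_comm, mul_comm (ENNReal.ofReal δ)]

/-- The local `W^{1,1}` trace inequality. -/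
lemma IsLipschitzChart.exists_trace_le {Ω : Set (E d)} {x e : E d} {h : E d → ℝ}
    {K : NNReal} {r : ℝ} (hc : IsLipschitzChart Ω x e h K r) (hΩ : IsOpen Ω) :
    ∃ C : ℝ≥0∞, C ≠ ⊤ ∧ ∀ φ : E d → ℂ, ContDiff ℝ ∞ φ →
      ∫⁻ y in Metric.ball x (r / 2), ‖φ y‖ₑ ∂(surf Ω)
        ≤ C * ((∫⁻ y in Ω, ‖φ y‖ₑ) + ∫⁻ y in Ω, ‖fderiv ℝ φ y e‖ₑ) := by
  obtain ⟨c, hcol⟩ := hc.exists_lintegral_collar_le hΩ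
  set δ := ENNReal.ofReal (r / 2) with hδ
  have hδ0 : δ ≠ 0 := by simpa [hδ] using hc.pos
  have hδt : δ ≠ ⊤ := ENNReal.ofReal_ne_top
  set M : ℝ≥0∞ := ((1 + K : NNReal) : ℝ≥0∞) ^ (d - 1)
  have hMt : M ≠ ⊤ := ENNReal.pow_ne_top ENNReal.coe_ne_top
  -- `M` is the area distortion of the graph map, `c` comes from Fubini in the collar, `δ⁻¹` from
  -- averaging over its height, and `1 + δ` dominates both coefficients `1` and `δ` of the segment
  -- inequality.
  refine ⟨M * (δ⁻¹ * ((1 + δ) * c)), ?_, fun φ hφ => ?_⟩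
  · exact ENNReal.mul_ne_top hMt (ENNReal.mul_ne_top (ENNReal.inv_ne_top.2 hδ0)
      (ENNReal.mul_ne_top (ENNReal.add_ne_top.2 ⟨ENNReal.one_ne_top, hδt⟩) ENNReal.coe_ne_top))
  have hG := lipschitzWith_graphMap hc.norm_eq hc.lipschitz
  have hGm := hG.continuous.measurable
  set S := graphMap e h ⁻¹' Metric.ball x (r / 2)
  have hm1 : Measurable fun y => ‖φ y‖ₑ := hφ.continuous.measurable.enorm
  have hm2 : Measurable fun y => ‖fderiv ℝ φ y e‖ₑ := by
    have h1 := hφ.continuous_fderiv (by simp)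
    have h2 : Continuous fun y => fderiv ℝ φ y e := by fun_prop
    exact h2.measurable.enorm
  have hp : Measurable fun p : perp e × ℝ => graphMap e h p.1 + p.2 • e := by fun_prop
  have hi : ∀ f : E d → ℝ≥0∞, Measurable f →
      Measurable fun v : perp e => ∫⁻ t in Set.Ioo 0 (r / 2), f (graphMap e h v + t • e) :=
    fun f hf => (hf.comp hp).lintegral_prod_right'
  have h1 : ∫⁻ y in Metric.ball x (r / 2), ‖φ y‖ₑ ∂(surf Ω)
      ≤ M * ∫⁻ v in S, ‖φ (graphMap e h v)‖ₑ ∂(perpMeasure e) := by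
    refine (lintegral_mono' (hc.surf_restrict_le hΩ (half_le_self hc.pos.le)) le_rfl).trans ?_
    rw [lintegral_smul_measure, lintegral_map hm1 hGm, smul_eq_mul]
  have h2 : δ * ∫⁻ v in S, ‖φ (graphMap e h v)‖ₑ ∂(perpMeasure e)
      ≤ (1 + δ) * c * ((∫⁻ y in Ω, ‖φ y‖ₑ) + ∫⁻ y in Ω, ‖fderiv ℝ φ y e‖ₑ) := by
    rw [← lintegral_const_mul δ (f := fun v => ‖φ (graphMap e h v)‖ₑ) (hm1.comp hGm)]
    refine (lintegral_mono fun v =>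
      mul_enorm_le_lintegral_segment hφ (graphMap e h v) e (r / 2)).trans ?_
    rw [lintegral_add_left (hi _ hm1), lintegral_const_mul _ (hi _ hm2)]
    calc _ ≤ c * (∫⁻ y in Ω, ‖φ y‖ₑ) + δ * (c * ∫⁻ y in Ω, ‖fderiv ℝ φ y e‖ₑ) := by
          gcongr
          · exact hcol _ hm1
          · exact hcol _ hm2
      _ ≤ (1 + δ) * (c * ∫⁻ y in Ω, ‖φ y‖ₑ) + (1 + δ) * (c * ∫⁻ y in Ω, ‖fderiv ℝ φ y e‖ₑ) :=
          add_le_add (le_mul_of_one_le_left' le_self_add) (mul_le_mul' le_add_self le_rfl)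
      _ = _ := by ring
  refine h1.trans ?_
  rw [mul_assoc M]
  gcongr
  rw [mul_assoc, ← ENNReal.mul_le_iff_le_inv hδ0 hδt]
  exact h2

/-! ## The trace operator is well defined -/

/-- Hölder on a finite measure space. It allows the `L¹` trace inequality to be applied to `L²`
limits. -/
lemma tendsto_lintegral_enorm_of_tendsto_eLpNorm {X : Type*} [MeasurableSpace X] {μ : Measure X}
    [IsFiniteMeasure μ] {f : ℕ → X → ℂ} (hf : ∀ n, AEStronglyMeasurable (f n) μ)
    (h : Tendsto (fun n => eLpNorm (f n) 2 μ) atTop (𝓝 0)) :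
    Tendsto (fun n => ∫⁻ x, ‖f n x‖ₑ ∂μ) atTop (𝓝 0) := by
  have h1 : ∀ n, ∫⁻ x, ‖f n x‖ₑ ∂μ ≤ μ Set.univ ^ ((1 : ℝ) / 2) * eLpNorm (f n) 2 μ := by
    intro n
    rw [← eLpNorm_one_eq_lintegral_enorm, mul_comm]
    have h2 := eLpNorm_le_eLpNorm_mul_rpow_measure_univ (p := 1) (q := 2) (by norm_num) (hf n)
    norm_num at h2 ⊢
    exact h2
  have h2 : Tendsto (fun n => μ Set.univ ^ ((1 : ℝ) / 2) * eLpNorm (f n) 2 μ) atTop (𝓝 0) := by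
    simpa using ENNReal.Tendsto.const_mul h
      (Or.inr (ENNReal.rpow_ne_top_of_nonneg (by norm_num) (measure_ne_top μ _)))
  exact tendsto_of_tendsto_of_tendsto_of_le_of_le tendsto_const_nhds h2 (fun _ => zero_le) h1

/-- Chart directions are arbitrary, while `H¹` convergence controls only the coordinate derivatives.
-/
lemma enorm_fderiv_le_sum_pd (φ : E d → ℂ) (y e : E d) :
    ‖fderiv ℝ φ y e‖ₑ ≤ ∑ i, ‖e i‖ₑ * ‖pd i φ y‖ₑ := by
  have h1 : e = ∑ i, e i • EuclideanSpace.single i (1 : ℝ) := by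
    ext j
    simp [Pi.single_apply]
  have h2 : fderiv ℝ φ y e = ∑ i, e i • pd i φ y := by
    conv_lhs => rw [h1]
    simp [pd]
  rw [h2]
  refine (enorm_sum_le _ _).trans (Finset.sum_le_sum fun i _ => ?_)
  rw [enorm_smul]

lemma surf_eq_inter_frontier {Ω A : Set (E d)} : surf Ω A = surf Ω (A ∩ frontier Ω) := by
  rw [surf, Measure.restrict_apply' isClosed_frontier.measurableSet,
    Measure.restrict_apply' isClosed_frontier.measurableSet, Set.inter_assoc, Set.inter_self]

/-- The trace is single valued: if smooth functions tend to `0` in `H¹(Ω)` and their boundary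
values converge in `L²(Γ)`, the limit of the boundary values is `0`. -/
lemma traceGraph_unique {Ω : Set (E d)} (hΩ : IsOpen Ω) (hb : Bornology.IsBounded Ω)
    (hL : HasLipschitzBoundary Ω) (p : L2 Ω × L2bd Ω) (hp : p ∈ traceGraph Ω) (h0 : p.1 = 0) :
    p.2 = 0 := by
  obtain ⟨u, g⟩ := p
  obtain rfl : u = 0 := h0
  obtain ⟨hu, φ, hφ, ⟨h1, h2⟩, h3⟩ := hp
  have := isFiniteMeasure_surf hΩ hb hL
  have : IsFiniteMeasure ((volume : Measure (E d)).restrict Ω) :=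
    isFiniteMeasure_restrict.2 hb.measure_lt_top.ne
  have hz : ∀ f : E d → ℂ, eLpNorm (f - ⇑(0 : L2 Ω)) 2 (volume.restrict Ω)
      = eLpNorm f 2 (volume.restrict Ω) := by
    intro f
    refine eLpNorm_congr_ae ?_
    filter_upwards [Lp.coeFn_zero ℂ 2 ((volume : Measure (E d)).restrict Ω)] with x hx
    rw [Pi.sub_apply, hx, Pi.zero_apply, sub_zero]
  have hD : ∀ i, D Ω i ⟨((0 : L2 Ω), g).1, hu⟩ = 0 := fun i => map_zero (D Ω i)
  simp only [hD, hz] at h1 h2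
  have k1 := tendsto_lintegral_enorm_of_tendsto_eLpNorm
    (fun n => (hφ n).continuous.aestronglyMeasurable) h1
  have k2 := fun i => tendsto_lintegral_enorm_of_tendsto_eLpNorm
    (fun n => (contDiff_pd i (hφ n)).continuous.aestronglyMeasurable) (h2 i)
  have k3 := tendsto_lintegral_enorm_of_tendsto_eLpNorm
    (fun n => (hφ n).continuous.aestronglyMeasurable.sub (Lp.aestronglyMeasurable g)) h3
  have k4 : ∀ e : E d, Tendsto (fun n => ∫⁻ y in Ω, ‖fderiv ℝ (φ n) y e‖ₑ) atTop (𝓝 0) := by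
    intro e
    have h : Tendsto (fun n => ∑ i, ‖e i‖ₑ * ∫⁻ y in Ω, ‖pd i (φ n) y‖ₑ) atTop (𝓝 0) := by
      have h5 := tendsto_finsetSum Finset.univ fun i _ =>
        ENNReal.Tendsto.const_mul (k2 i) (Or.inr (enorm_ne_top (x := e i)))
      simpa using h5
    refine tendsto_of_tendsto_of_tendsto_of_le_of_le tendsto_const_nhds h (fun _ => zero_le) ?_
    intro n
    have hm : ∀ i, Measurable fun y => ‖pd i (φ n) y‖ₑ :=
      fun i => (contDiff_pd i (hφ n)).continuous.measurable.enorm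
    refine (lintegral_mono fun y => enorm_fderiv_le_sum_pd (φ n) y e).trans ?_
    rw [lintegral_finsetSum _ fun i _ => (hm i).const_mul _]
    simp only [lintegral_const_mul _ (hm _)]
    exact le_rfl
  have hgm : AEMeasurable (fun y => ‖g y‖ₑ) (surf Ω) := (Lp.aestronglyMeasurable g).enorm
  rw [Lp.eq_zero_iff_ae_eq_zero]
  change surf Ω {y | g y = 0}ᶜ = 0
  rw [surf_eq_inter_frontier]
  -- Charts exist only at boundary points, so the vanishing of `g` is checked locally on `frontier
  -- Ω`, which carries the measure.
  refine measure_null_of_locally_null _ fun x hx => ?_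
  obtain ⟨e, h, K, r, hc⟩ := hL.exists_chart hx.2
  obtain ⟨C, hC, hle⟩ := hc.exists_trace_le hΩ
  set B := Metric.ball x (r / 2)
  have hlim : Tendsto (fun n => (∫⁻ y, ‖(φ n - ⇑g) y‖ₑ ∂(surf Ω))
      + C * ((∫⁻ y in Ω, ‖φ n y‖ₑ) + ∫⁻ y in Ω, ‖fderiv ℝ (φ n) y e‖ₑ)) atTop (𝓝 0) := by
    simpa using k3.add (ENNReal.Tendsto.const_mul (k1.add (k4 e)) (Or.inr hC))
  -- `|g| ≤ |φ n - g| + |φ n|`: the first term tends to `0` in `L¹(Γ)`, and the trace inequality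
  -- bounds the second by interior integrals tending to `0`.
  have hint : ∫⁻ y in B, ‖g y‖ₑ ∂(surf Ω) = 0 := by
    refine le_antisymm (ge_of_tendsto' hlim fun n => ?_) zero_le
    calc ∫⁻ y in B, ‖g y‖ₑ ∂(surf Ω)
        ≤ ∫⁻ y in B, (‖(φ n - ⇑g) y‖ₑ + ‖φ n y‖ₑ) ∂(surf Ω) := by
          refine lintegral_mono fun y => ?_
          have h5 : g y = φ n y - (φ n - ⇑g) y := by simp
          calc ‖g y‖ₑ = ‖φ n y - (φ n - ⇑g) y‖ₑ := by rw [← h5]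
            _ ≤ ‖φ n y‖ₑ + ‖(φ n - ⇑g) y‖ₑ := enorm_sub_le
            _ = _ := add_comm _ _
      _ = (∫⁻ y in B, ‖(φ n - ⇑g) y‖ₑ ∂(surf Ω)) + ∫⁻ y in B, ‖φ n y‖ₑ ∂(surf Ω) :=
          lintegral_add_right _ (hφ n).continuous.measurable.enorm
      _ ≤ _ := add_le_add (setLIntegral_le_lintegral _ _) (hle _ (hφ n))
  rw [lintegral_eq_zero_iff' hgm.restrict] at hint
  refine ⟨({y | g y = 0}ᶜ ∩ B), ?_, ?_⟩
  · refine mem_of_superset (inter_mem self_mem_nhdsWithin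
      (mem_nhdsWithin_of_mem_nhds (Metric.ball_mem_nhds x (half_pos hc.pos)))) ?_
    exact fun y hy => ⟨hy.1.1, hy.2⟩
  · have h5 : (surf Ω).restrict B {y | g y = 0}ᶜ = 0 := by
      change ∀ᵐ y ∂((surf Ω).restrict B), g y = 0
      filter_upwards [hint] with y hy
      simpa using hy
    rwa [Measure.restrict_apply' measurableSet_ball] at h5

/-- Two values over the same point differ by an element of the fibre over `0`, which `hg` makes
trivial. This is how both `D` and `trace` are evaluated. -/
lemma toLinearPMap_apply_eq {V W : Type*} [AddCommGroup V] [Module ℂ V] [AddCommGroup W]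
    [Module ℂ W] {g : Submodule ℂ (V × W)} (hg : ∀ p ∈ g, p.1 = 0 → p.2 = 0) {x : V} {y : W}
    (hxy : (x, y) ∈ g) (hx : x ∈ g.toLinearPMap.domain) : g.toLinearPMap ⟨x, hx⟩ = y := by
  have h1 : (x, g.toLinearPMap ⟨x, hx⟩) ∈ g := Submodule.mem_graph_toLinearPMap hg ⟨x, hx⟩
  exact sub_eq_zero.1 (hg _ (g.sub_mem h1 hxy) (sub_self x))

/-! ## Smooth functions and their traces -/

lemma memLp_of_contDiff {φ : E d → ℂ} (hφ : ContDiff ℝ ∞ φ) (hs : HasCompactSupport φ)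
    (μ : Measure (E d)) [IsFiniteMeasure μ] : MemLp φ 2 μ :=
  hφ.continuous.memLp_of_hasCompactSupport hs

lemma mem_weakPartialGraph_of_contDiff {Ω : Set (E d)} {φ : E d → ℂ} (hφ : ContDiff ℝ ∞ φ)
    {u v : L2 Ω} (i : Fin d) (hu : u =ᵐ[volume.restrict Ω] φ)
    (hv : v =ᵐ[volume.restrict Ω] pd i φ) : (u, v) ∈ weakPartialGraph Ω i := by
  intro θ hθ
  -- Test functions are supported in `Ω`, so the integrals extend to `ℝ^d`, where integration by
  -- parts has no boundary term.
  have hr : ∀ (ψ : E d → ℝ) (χ : E d → ℂ) (w : L2 Ω), IsTest Ω ψ → w =ᵐ[volume.restrict Ω] χ →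
      ∫ x in Ω, ψ x • w x = ∫ x, ψ x • χ x := by
    intro ψ χ w hψ hw
    have h1 : ∫ x in Ω, ψ x • w x = ∫ x in Ω, ψ x • χ x := by
      refine integral_congr_ae ?_
      filter_upwards [hw] with x hx
      rw [hx]
    rw [h1]
    refine setIntegral_eq_integral_of_forall_compl_eq_zero fun x hx => ?_
    rw [image_eq_zero_of_notMem_tsupport fun h => hx (hψ.subset h), zero_smul]
  have hi : ∀ (ψ : E d → ℝ) (χ : E d → ℂ), IsTest Ω ψ → ContDiff ℝ ∞ χ →
      Integrable (fun x => ψ x • χ x) := fun ψ χ hψ hχ =>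
    (hψ.smooth.continuous.smul hχ.continuous).integrable_of_hasCompactSupport hψ.compact.smul_right
  have hparts := integral_smul_fderiv_eq_neg_fderiv_smul_of_integrable (hi _ _ (hθ.pd i) hφ)
    (hi _ _ hθ (contDiff_pd i hφ)) (hi _ _ hθ hφ)
    (fun x _ => hθ.smooth.differentiable (by simp) x) (fun x _ => hφ.differentiable (by simp) x)
  rw [hr _ φ _ (hθ.pd i) hu, hr _ (pd i φ) _ hθ hv]
  exact (neg_eq_iff_eq_neg.2 hparts).symm

/-- A smooth compactly supported function lies in `H¹(Ω)`, and its trace is its restriction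
to the boundary. -/
lemma mem_traceGraph_of_contDiff {Ω : Set (E d)} (hΩ : IsOpen Ω) (hb : Bornology.IsBounded Ω)
    {φ : E d → ℂ} (hφ : ContDiff ℝ ∞ φ) (hs : HasCompactSupport φ) {u : L2 Ω} {g : L2bd Ω}
    (hu : u =ᵐ[volume.restrict Ω] φ) (hg : g =ᵐ[surf Ω] φ) : (u, g) ∈ traceGraph Ω := by
  have : IsFiniteMeasure ((volume : Measure (E d)).restrict Ω) :=
    isFiniteMeasure_restrict.2 hb.measure_lt_top.ne
  have hpd : ∀ i, MemLp (pd i φ) 2 ((volume : Measure (E d)).restrict Ω) := fun i =>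
    memLp_of_contDiff (contDiff_pd i hφ) (hs.fderiv_apply (𝕜 := ℝ) _) _
  have hmem : ∀ i, (u, (hpd i).toLp) ∈ weakPartialGraph Ω i := fun i =>
    mem_weakPartialGraph_of_contDiff hφ i hu (hpd i).coeFn_toLp
  have hu1 : u ∈ H1 Ω := by
    rw [H1, Submodule.mem_iInf]
    exact fun i => Submodule.mem_map.2 ⟨_, hmem i, rfl⟩
  have hD : ∀ i, D Ω i ⟨u, hu1⟩ = (hpd i).toLp := fun i =>
    toLinearPMap_apply_eq (fun p hp h0 => weakPartialGraph_unique hΩ i p hp h0) (hmem i) _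
  have hz : ∀ {μ : Measure (E d)} {f : E d → ℂ} {w : Lp ℂ 2 μ}, w =ᵐ[μ] f →
      Tendsto (fun _ : ℕ => eLpNorm (f - ⇑w) 2 μ) atTop (𝓝 0) := by
    intro μ f w hw
    have h1 : eLpNorm (f - ⇑w) 2 μ = 0 := by
      rw [← eLpNorm_zero (ε := ℂ) (μ := μ) (p := 2)]
      refine eLpNorm_congr_ae ?_
      filter_upwards [hw] with x hx
      simp [hx]
    rw [h1]
    exact tendsto_const_nhds
  refine ⟨hu1, fun _ => φ, fun _ => hφ, ⟨hz hu, fun i => ?_⟩, hz hg⟩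
  rw [hD i]
  exact hz (hpd i).coeFn_toLp

lemma IsAdmissible.exists_traceΓ₀_ne_zero {Ω Γ₀ Γ₁ : Set (E d)} (hA : IsAdmissible Ω Γ₀ Γ₁) :
    ∃ φ : H1Γ₀ Ω Γ₀, ¬ (traceΓ₀ Ω Γ₀ φ =ᵐ[(surf Ω).restrict Γ₁] 0) := by
  obtain ⟨x, hx⟩ := hA.nonempty₁
  obtain ⟨O₀, hO₀, hΓ₀⟩ := hA.relOpen₀
  obtain ⟨O₁, hO₁, hΓ₁⟩ := hA.relOpen₁
  have hx0 : (closure Γ₀)ᶜ ∈ 𝓝 x := isClosed_closure.isOpen_compl.mem_nhds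
    fun h => Set.disjoint_left.1 hA.disjoint h (subset_closure hx)
  -- A smooth bump with `ψ x = 1`, supported off the closure of `Γ₀`, so that its trace vanishes on
  -- `Γ₀`.
  obtain ⟨ψ, h1, h2, h3, -, h4⟩ := exists_contDiff_tsupport_subset (n := ⊤) hx0
  set φ : E d → ℂ := fun y => (ψ y : ℂ) with hφdef
  have hφ : ContDiff ℝ ∞ φ := Complex.ofRealCLM.contDiff.comp h3
  have hs : HasCompactSupport φ := h2.comp_left Complex.ofReal_zero
  have := isFiniteMeasure_surf hA.isOpen hA.isBounded hA.lipschitz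
  have : IsFiniteMeasure ((volume : Measure (E d)).restrict Ω) :=
    isFiniteMeasure_restrict.2 hA.isBounded.measure_lt_top.ne
  have hu := memLp_of_contDiff hφ hs ((volume : Measure (E d)).restrict Ω)
  have hg := memLp_of_contDiff hφ hs (surf Ω)
  have hmem := mem_traceGraph_of_contDiff hA.isOpen hA.isBounded hφ hs hu.coeFn_toLp hg.coeFn_toLp
  have hdom : hu.toLp ∈ (trace Ω).domain := Submodule.mem_map.2 ⟨_, hmem, rfl⟩
  have htr : trace Ω ⟨hu.toLp, hdom⟩ = hg.toLp :=
    toLinearPMap_apply_eq (traceGraph_unique hA.isOpen hA.isBounded hA.lipschitz) hmem hdom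
  have hm₀ : MeasurableSet Γ₀ := hΓ₀ ▸ hO₀.measurableSet.inter isClosed_frontier.measurableSet
  have hm₁ : MeasurableSet Γ₁ := hΓ₁ ▸ hO₁.measurableSet.inter isClosed_frontier.measurableSet
  have hH : hu.toLp ∈ H1Γ₀ Ω Γ₀ := by
    refine ⟨hmem.choose, hdom, ?_⟩
    rw [htr]
    filter_upwards [ae_restrict_of_ae hg.coeFn_toLp, ae_restrict_mem hm₀] with y hy hy0
    have h5 : ψ y = 0 := image_eq_zero_of_notMem_tsupport fun h => h1 h (subset_closure hy0)
    rw [hy, hφdef]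
    simp [h5]
  refine ⟨⟨_, hH⟩, fun hzero => ?_⟩
  have htr' : traceΓ₀ Ω Γ₀ ⟨hu.toLp, hH⟩ = hg.toLp := htr
  rw [htr'] at hzero
  have h5 : ∀ᵐ y ∂(surf Ω).restrict Γ₁, ψ y = 0 := by
    filter_upwards [ae_restrict_of_ae hg.coeFn_toLp, hzero] with y hy hy0
    rw [hy] at hy0
    simpa [hφdef] using hy0
  have h6 : surf Ω ({y | ψ y = 0}ᶜ ∩ Γ₁) = 0 := by
    rw [← Measure.restrict_apply' hm₁]
    exact h5
  -- This open set contains `x` and meets the boundary inside `Γ₁`; by `surf_pos` its surface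
  -- measure is positive, against `h6`.
  have hU : IsOpen ({y | ψ y = 0}ᶜ ∩ O₁) :=
    (isClosed_singleton.preimage h3.continuous).isOpen_compl.inter hO₁
  rw [hΓ₁] at hx
  have h7 := surf_pos hA.isOpen hA.lipschitz hU hx.2 ⟨by simp [h4], hx.1⟩
  rw [surf_eq_inter_frontier, Set.inter_assoc, ← hΓ₁, h6] at h7
  exact lt_irrefl _ h7

/-! ## Failure of surjectivity -/

/-- A power of the norm with exponent below the critical one is not integrable (by scaling). -/
lemma not_integrable_norm_rpow (hd : d ≠ 0) {t : ℝ} (ht : t < -d) :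
    ¬ Integrable (fun ξ : E d => ‖ξ‖ ^ t) := by
  have : Nonempty (Fin d) := ⟨⟨0, Nat.pos_of_ne_zero hd⟩⟩
  intro hi
  have h1 := Measure.integral_comp_smul (volume : Measure (E d)) (fun ξ : E d => ‖ξ‖ ^ t) 2
  have h2 : ∀ ξ : E d, ‖(2 : ℝ) • ξ‖ ^ t = 2 ^ t * ‖ξ‖ ^ t := fun ξ => by
    rw [norm_smul, Real.mul_rpow (norm_nonneg _) (norm_nonneg _)]
    simp
  simp only [h2, integral_const_mul, finrank_euclideanSpace_fin, smul_eq_mul] at h1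
  rw [abs_of_nonneg (by positivity), ← Real.rpow_natCast, ← Real.rpow_neg (by norm_num)] at h1
  -- Dilation by `2` multiplies the integral by `2 ^ (-d)`, homogeneity by `2 ^ t`. These differ, so
  -- the integral is `0`.
  have h3 : (2 : ℝ) ^ t < 2 ^ (-(d : ℝ)) := Real.rpow_lt_rpow_of_exponent_lt (by norm_num) ht
  have h4 : ∫ ξ : E d, ‖ξ‖ ^ t = 0 := by
    by_contra h
    exact h3.ne (mul_right_cancel₀ h h1)
  -- Integrability is essential here: otherwise the integral is `0` by convention. A zero integral
  -- forces a function positive off the origin to vanish almost everywhere.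
  rw [integral_eq_zero_iff_of_nonneg (fun ξ => by positivity) hi] at h4
  have h5 : volume ({0}ᶜ : Set (E d)) = 0 := by
    refine measure_mono_null (fun ξ hξ => ?_) h4
    exact (Real.rpow_pos_of_pos (norm_pos_iff.2 hξ) t).ne'
  have h6 : (Set.univ : Set (E d)) = {0} ∪ {0}ᶜ := by simp
  have h7 : volume (Set.univ : Set (E d)) = 0 := by
    rw [h6]
    exact measure_union_null (measure_singleton _) h5
  exact NeZero.ne _ (Measure.measure_univ_eq_zero.1 h7)

/-- By Tonelli the squared norm is a product. Its factor in `τ` is nonzero, so a finite product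
would make `‖ξ‖ ^ (2 * s)` integrable. -/
lemma not_memLp_norm_rpow_mul (hd : d ≠ 0) {μ : Measure (E d)} {s : ℝ}
    (hs : 2 * s < -d) {τ : E d → ℂ} (hτ : AEStronglyMeasurable τ μ) (h0 : ¬ τ =ᵐ[μ] 0) :
    ¬ MemLp (fun p : E d × E d => ((‖p.2‖ ^ s : ℝ) : ℂ) * τ p.1) 2 (μ.prod volume) := by
  intro h
  have h1 := (memLp_two_iff_integrable_sq_norm h.1).1 h
  have h2 := h1.2
  rw [hasFiniteIntegral_iff_enorm] at h2
  have hm : Measurable fun ξ : E d => ‖ξ‖ ^ (2 * s) := by fun_prop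
  have h3 : ∀ p : E d × E d, ‖‖((‖p.2‖ ^ s : ℝ) : ℂ) * τ p.1‖ ^ 2‖ₑ
      = ‖τ p.1‖ₑ ^ 2 * ‖‖p.2‖ ^ (2 * s)‖ₑ := by
    intro p
    have h4 : ‖p.2‖ ^ (2 * s) = (‖p.2‖ ^ s) ^ 2 := by
      rw [mul_comm, Real.rpow_mul (norm_nonneg _)]
      norm_cast
    rw [norm_mul, h4, mul_pow, enorm_mul, mul_comm]
    simp [enorm_pow]
  simp only [h3] at h2
  rw [lintegral_prod_mul (hτ.enorm.pow_const 2) hm.enorm.aemeasurable] at h2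
  have h5 : ∫⁻ x, ‖τ x‖ₑ ^ 2 ∂μ ≠ 0 := by
    rw [Ne, lintegral_eq_zero_iff' (hτ.enorm.pow_const 2)]
    intro h6
    refine h0 ?_
    filter_upwards [h6] with x hx
    simpa using hx
  refine not_integrable_norm_rpow hd hs ⟨hm.aestronglyMeasurable, ?_⟩
  rw [hasFiniteIntegral_iff_enorm]
  by_contra h6
  rw [not_lt, top_le_iff] at h6
  rw [h6, ENNReal.mul_top h5] at h2
  exact lt_irrefl _ h2

/-- If `-A U = (φ, 0, 0, 0, 0)` with `η = 0`, then `|ξ|^{(2α-d-4)/2} φ|_{Γ₁}` is in `L²`. -/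
lemma memLp_of_neg_opA_eq (hd : d ≠ 0) {Ω Γ₀ Γ₁ : Set (E d)} {a b γ α : ℝ} {φ : H1Γ₀ Ω Γ₀}
    {U : (-(opA Ω Γ₀ Γ₁ a b γ α 0)).domain}
    (hU : (-(opA Ω Γ₀ Γ₁ a b γ α 0)) U = (φ, 0, 0, 0, 0)) :
    MemLp (fun p : E d × E d =>
      ((‖p.2‖ ^ ((2 * α - d - 4) / 2) : ℝ) : ℂ) * traceΓ₀ Ω Γ₀ φ p.1) 2 (surfProd Ω Γ₁) := by
  have : Nonempty (Fin d) := ⟨⟨0, Nat.pos_of_ne_zero hd⟩⟩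
  obtain ⟨U, hdom⟩ := U
  change U ∈ domA Ω Γ₀ Γ₁ γ α 0 at hdom
  rw [LinearPMap.neg_apply, neg_eq_iff_eq_neg] at hU
  have hv : (⟨U.2.1, domA_v hdom⟩ : H1Γ₀ Ω Γ₀) = -φ := congrArg Prod.fst hU
  have hw : (domA_w hdom).toLp = -(0 : L2aux Ω Γ₁) := congrArg (fun V => V.2.2.2.2) hU
  have h1 : auxFun 0 α (traceΓ₀ Ω Γ₀ ⟨U.2.1, domA_v hdom⟩) U.2.2.2.2 =ᵐ[surfProd Ω Γ₁] 0 := by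
    refine (domA_w hdom).coeFn_toLp.symm.trans ?_
    rw [hw, neg_zero]
    exact Lp.coeFn_zero ℂ 2 (surfProd Ω Γ₁)
  rw [hv, map_neg] at h1
  have h2 := (Measure.quasiMeasurePreserving_fst (μ := (surf Ω).restrict Γ₁)
    (ν := (volume : Measure (E d)))).ae (ae_restrict_of_ae (Lp.coeFn_neg (traceΓ₀ Ω Γ₀ φ)))
  have h3 : ∀ᵐ p ∂(surfProd Ω Γ₁), p.2 ≠ 0 :=
    (Measure.quasiMeasurePreserving_snd (μ := (surf Ω).restrict Γ₁)
      (ν := (volume : Measure (E d)))).ae (Measure.ae_ne volume 0)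
  -- The function in question is `-ω`, square integrable because `U` lies in the energy space. The
  -- identity is obtained by dividing by `‖ξ‖ ^ 2`, legitimate off the null set `ξ = 0`.
  refine (Lp.memLp U.2.2.2.2).neg.ae_eq ?_
  filter_upwards [h1, h2, h3] with p h1 h2 h3
  have hpos : 0 < ‖p.2‖ := norm_pos_iff.2 h3
  rw [auxFun, h2, Pi.neg_apply, Pi.zero_apply, add_zero] at h1
  have h4 : mu α p.2 = ‖p.2‖ ^ ((2 * α - d - 4) / 2) * ‖p.2‖ ^ 2 := by
    rw [mu, ← Real.rpow_natCast, ← Real.rpow_add hpos]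
    congr 1
    push_cast
    ring
  rw [h4] at h1
  have h5 : ((‖p.2‖ ^ 2 : ℝ) : ℂ) ≠ 0 := by exact_mod_cast (pow_pos hpos 2).ne'
  rw [Pi.neg_apply]
  refine mul_left_cancel₀ h5 ?_
  push_cast at h1 ⊢
  linear_combination h1

end CoupledWave

end

theorem mainTheorem4 {d : ℕ} (hd : 2 ≤ d) (Ω Γ₀ Γ₁ : Set (CoupledWave.E d))
    (hΩ : CoupledWave.IsAdmissible Ω Γ₀ Γ₁)
    (a b γ α η : ℝ) (ha : 0 < a) (hb : b ≠ 0) (hγ : 0 < γ) (hα₀ : 0 < α) (hα₁ : α < 1)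
    (hη : η = 0) :
    ¬ CoupledWave.IsInvertible (CoupledWave.energyNorm Ω Γ₀ Γ₁ a γ α)
        (-(CoupledWave.opA Ω Γ₀ Γ₁ a b γ α η)) ∧
    (0 : ℂ) ∈ CoupledWave.spectrumOf (CoupledWave.energyNorm Ω Γ₀ Γ₁ a γ α)
        (CoupledWave.opA Ω Γ₀ Γ₁ a b γ α η) ∧
    (∃ φ : CoupledWave.H1Γ₀ Ω Γ₀,
      ¬ (CoupledWave.traceΓ₀ Ω Γ₀ φ =ᵐ[(CoupledWave.surf Ω).restrict Γ₁] 0)) ∧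
    (∀ φ : CoupledWave.H1Γ₀ Ω Γ₀,
      ¬ (CoupledWave.traceΓ₀ Ω Γ₀ φ =ᵐ[(CoupledWave.surf Ω).restrict Γ₁] 0) →
        ¬ MemLp (fun p : CoupledWave.E d × CoupledWave.E d =>
            ((‖p.2‖ ^ ((2 * α - d - 4) / 2) : ℝ) : ℂ) * CoupledWave.traceΓ₀ Ω Γ₀ φ p.1)
          2 (CoupledWave.surfProd Ω Γ₁) ∧
        ¬ ∃ U : (-(CoupledWave.opA Ω Γ₀ Γ₁ a b γ α η)).domain,
          (-(CoupledWave.opA Ω Γ₀ Γ₁ a b γ α η)) U = (φ, 0, 0, 0, 0)) := by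
  subst hη
  have hd0 : d ≠ 0 := by omega
  have hL2 : ∀ φ : CoupledWave.H1Γ₀ Ω Γ₀,
      ¬ (CoupledWave.traceΓ₀ Ω Γ₀ φ =ᵐ[(CoupledWave.surf Ω).restrict Γ₁] 0) →
        ¬ MemLp (fun p : CoupledWave.E d × CoupledWave.E d =>
            ((‖p.2‖ ^ ((2 * α - d - 4) / 2) : ℝ) : ℂ) * CoupledWave.traceΓ₀ Ω Γ₀ φ p.1)
          2 (CoupledWave.surfProd Ω Γ₁) := fun φ hφ =>
    -- The exponent condition reads `2α - d - 4 < -d`, which follows from `α < 1`.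
    CoupledWave.not_memLp_norm_rpow_mul hd0 (by linarith)
      (Lp.aestronglyMeasurable (CoupledWave.traceΓ₀ Ω Γ₀ φ)).restrict hφ
  obtain ⟨φ, hφ⟩ := hΩ.exists_traceΓ₀_ne_zero
  have hinv : ¬ CoupledWave.IsInvertible (CoupledWave.energyNorm Ω Γ₀ Γ₁ a γ α)
      (-(CoupledWave.opA Ω Γ₀ Γ₁ a b γ α 0)) := fun h => by
    obtain ⟨U, hU⟩ := h.1.2 (φ, 0, 0, 0, 0)
    exact hL2 φ hφ (CoupledWave.memLp_of_neg_opA_eq hd0 hU)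
  refine ⟨hinv, ?_, ⟨φ, hφ⟩, fun ψ hψ => ⟨hL2 ψ hψ, ?_⟩⟩
  · change ¬ CoupledWave.IsInvertible _ (CoupledWave.shift 0 _)
    rw [CoupledWave.shift, zero_smul, zero_vadd]
    exact hinv
  · rintro ⟨U, hU⟩
    exact hL2 ψ hψ (CoupledWave.memLp_of_neg_opA_eq hd0 hU)
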